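/- Let $\overline{\mathbb{Q}}$ be an algebraic closure of $\mathbb{Q}$. Let $\mathrm{Rat}_d$ be the set of rational functions $\phi=p/q\in\overline{\mathbb{Q}}(x)$ (with $p,q$ coprime polynomials) of degree $\max\{\deg p,\deg q\}=d$. For $\phi\in\mathrm{Rat}_2$ let $[\phi]=\{\sigma^{-1}\circ\phi\circ\sigma:\sigma\in\mathrm{Rat}_1\}$ be its linear conjugacy class over $\overline{\mathbb{Q}}$, let $\mathcal{M}_2(\overline{\mathbb{Q}})=\{[\phi]:\phi\in\mathrm{Rat}_2\}$, and let $\mathrm{Aut}(\phi)=\{\sigma\in\mathrm{Rat}_1:\sigma^{-1}\circ\phi\circ\sigma=\phi\}$. Let $$\mathcal{S}=\{[\phi]\in\mathcal{M}_2(\overline{\mathbb{Q}}):\mathrm{Aut}(\phi)\text{ is nontrivial}\}.$$ For $n\ge 1$, let $C_n$ be the set of all $[\phi]\in\mathcal{M}_2(\overline{\mathbb{Q}})$ such that the map $\phi:\mathbb{P}^1(\overline{\mathbb{Q}})\to\mathbb{P}^1(\overline{\mathbb{Q}})$ has a critical point (that is, a point where $\phi$ is ramified) which is periodic with least period $n$.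 The field of moduli of $[\phi]$ is the subfield of $\overline{\mathbb{Q}}$ fixed by all $\tau\in\mathrm{Gal}(\overline{\mathbb{Q}}/\mathbb{Q})$ such that $\phi^\tau\in[\phi]$, where $\phi^\tau$ is obtained by applying $\tau$ to the coefficients of $\phi$. Then: (a) $C_2\cap\mathcal{S}=\{[1/x^2]\}$; (b) $C_3\cap\mathcal{S}$ has exactly four elements, and the field of moduli of each of them is a number field of degree $4$ over $\mathbb{Q}$; (c) $C_4\cap\mathcal{S}$ has exactly eight elements, and the field of moduli of each of them is a number field of degree $2$ or $6$ over $\mathbb{Q}$. -/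

import Mathlib

open Polynomial

noncomputable section

namespace QuadDyn

section RationalFunctions

variable {K : Type*} [Field K]

/-- The degree of a rational function `φ = p / q` in lowest terms: `max (deg p) (deg q)`. -/
def deg (φ : RatFunc K) : ℕ := max φ.num.natDegree φ.denom.natDegree

variable (K) in
/-- `Rat_d(K)`: the rational functions of degree `d` over `K`. -/
def Rat (d : ℕ) : Set (RatFunc K) := {φ | deg φ = d}

/-- The composition `φ ∘ ψ` of rational functions, that is, `φ` with `ψ` substituted for the
variable. It is meaningful whenever `ψ` is nonconstant, since then the denominator of `φ` does not
vanish at `ψ`. -/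
def comp (φ ψ : RatFunc K) : RatFunc K := RatFunc.eval RatFunc.C ψ φ

/-- `ψ = σ⁻¹ ∘ φ ∘ σ`, where `σ` has degree one and `τ = σ⁻¹` is its inverse under
composition. -/
def IsConjBy (σ φ ψ : RatFunc K) : Prop :=
  σ ∈ Rat K 1 ∧ ∃ τ ∈ Rat K 1,
    comp σ τ = RatFunc.X ∧ comp τ σ = RatFunc.X ∧ ψ = comp τ (comp φ σ)

/-- The linear conjugacy class `[φ]` of `φ` over `K`: all `σ⁻¹ ∘ φ ∘ σ` with `σ ∈ Rat_1(K)`. -/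
def conjClass (φ : RatFunc K) : Set (RatFunc K) := {ψ | ∃ σ, IsConjBy σ φ ψ}

variable (K) in
/-- `M_d(K)`, for `K` algebraically closed: the set `Rat_d(K) / PGL_2(K)` of linear conjugacy
classes of rational functions of degree `d`. -/
def Moduli (d : ℕ) : Set (Set (RatFunc K)) := conjClass '' Rat K d

/-- The automorphism group of `φ` (as a set): all `σ ∈ Rat_1(K)` with `σ⁻¹ ∘ φ ∘ σ = φ`. -/
def Aut (φ : RatFunc K) : Set (RatFunc K) := {σ | IsConjBy σ φ φ}

/-- The self-map of the projective line `K ∪ {∞}` induced by a rational function. -/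
def toMap (φ : RatFunc K) : OnePoint K → OnePoint K
  | none =>
    open Classical in
    if φ.denom.coeff (deg φ) = 0 then OnePoint.infty
    else ((φ.num.coeff (deg φ) / φ.denom.coeff (deg φ) : K) : OnePoint K)
  | some x =>
    open Classical in
    if φ.denom.eval x = 0 then OnePoint.infty
    else ((φ.num.eval x / φ.denom.eval x : K) : OnePoint K)

/-- For `φ = p / q` in lowest terms and a point `Q` of the projective line, the polynomial
(dehomogenizing a form of degree `deg φ`) whose roots are the points of the fibre over `Q`:
`p - Q q` for finite `Q`, and `q` for `Q = ∞`. -/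
def fiberPoly (φ : RatFunc K) : OnePoint K → K[X]
  | none => φ.denom
  | some y => φ.num - C y * φ.denom

/-- The ramification index of a nonconstant `φ` at `P`: the multiplicity of `P` in the fibre of
`φ` over `φ(P)`. At `P = ∞` this is the order of vanishing at `∞` of the degree-`deg φ` form whose
dehomogenization is `fiberPoly φ (φ(∞))`. -/
def ramificationIndex (φ : RatFunc K) : OnePoint K → ℕ
  | none => deg φ - (fiberPoly φ (toMap φ OnePoint.infty)).natDegree
  | some x => (fiberPoly φ (toMap φ (x : OnePoint K))).rootMultiplicity x

/-- A critical point of `φ` is a point where `φ` is ramified. -/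
def IsCriticalPoint (φ : RatFunc K) (P : OnePoint K) : Prop := 1 < ramificationIndex φ P

/-- `P` is an `n`-periodic point of `φ`: it is periodic, and `n` is its least period. -/
def IsPeriodicOfPeriod (φ : RatFunc K) (n : ℕ) (P : OnePoint K) : Prop :=
  0 < n ∧ Function.minimalPeriod (toMap φ) P = n

variable (K) in
/-- `C_n`, for `K` algebraically closed: the set of all `[φ] ∈ M_2(K)` such that `φ` has an
`n`-periodic critical point. -/
def perCurve (n : ℕ) : Set (Set (RatFunc K)) :=
  {c | ∃ φ ∈ Rat K 2, c = conjClass φ ∧ ∃ P, IsCriticalPoint φ P ∧ IsPeriodicOfPeriod φ n P}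

variable (K) in
/-- The symmetry locus `S`, for `K` algebraically closed: the set of all `[φ] ∈ M_2(K)` such that
`Aut(φ)` is nontrivial. -/
def symmetryLocus : Set (Set (RatFunc K)) :=
  {c | ∃ φ ∈ Rat K 2, c = conjClass φ ∧ ∃ σ ∈ Aut φ, σ ≠ RatFunc.X}

end RationalFunctions

section FieldOfModuli

variable {k L : Type*} [Field k] [Field L] [Algebra k L]

/-- The rational function `φ^τ` obtained by applying `τ` to the coefficients of `φ`. -/
def galConj (τ : L ≃ₐ[k] L) (φ : RatFunc L) : RatFunc L :=
  algebraMap L[X] (RatFunc L) (φ.num.map (τ : L →+* L)) /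
    algebraMap L[X] (RatFunc L) (φ.denom.map (τ : L →+* L))

variable (k) in
/-- The field of moduli `k_φ` of `φ ∈ L(x)`, where `L` is an algebraic closure of `k`: the subfield
of `L` fixed by all `τ ∈ Gal(L/k)` such that `φ^τ` is linearly conjugate to `φ` over `L`. -/
def fieldOfModuli (φ : RatFunc L) : IntermediateField k L where
  carrier := {x | ∀ τ : L ≃ₐ[k] L, galConj τ φ ∈ conjClass φ → τ x = x}
  mul_mem' := fun ha hb τ h => by rw [map_mul, ha τ h, hb τ h]
  add_mem' := fun ha hb τ h => by rw [map_add, ha τ h, hb τ h]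
  algebraMap_mem' := fun r τ _ => τ.commutes r
  inv_mem' := fun x hx τ h => by rw [map_inv₀, hx τ h]

end FieldOfModuli

end QuadDyn

end

/-! A quadratic map φ with a nontrivial automorphism is conjugate to some `sym u`, x ↦ (u/2)(x +
1/x) with u ≠ 0. Indeed the automorphism fixes a point; with that point at ∞ it is affine. No
quadratic map commutes with a translation in characteristic zero, so there is a second fixed point,
and with that one at 0 the automorphism is a homothety. Equivariance then kills enough coefficients
of φ to recognise `sym u` (`exists_mapConj_sym`). Moreover u depends only on the conjugacy class
(`eq_of_mapConj_sym`), so the nonzero u parametrise the symmetry locus.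

The critical points ±1 of `sym u` are exchanged by its automorphism x ↦ -x, hence have the same
period. Lying in C_n therefore means that the orbit 1, u, (u² + 1)/2, … closes up with least period
n. For n = 2 this says u = -1, the class of 1/x². For n = 3 it is a quartic in u, and for n = 4 it
is (u² + 3)(u⁶ + 2u⁴ + 5u² + 8) = 0. The quartic and both factors are irreducible over ℚ, so the
roots are distinct and there are 4 and 2 + 6 classes.

Applying τ to the coefficients turns `sym u` into `sym (τ u)`, which is conjugate to `sym u` only if
τ u = u. Hence the field of moduli is ℚ(u) (`fieldOfModuli_eq_adjoin`), and its degree is that of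
the irreducible factor.

Conjugacy is handled through self-maps of the projective line: over an infinite field a rational
function is determined by its map (`toMap_injective`). -/

noncomputable section

namespace QuadDyn

/-! ### Homogeneous coordinates on the projective line -/

section ProjectiveCoordinates

variable {K : Type*} [Field K]

open Classical in
/-- The point of the projective line with homogeneous coordinates `[a : b]`. -/
def ratio (a b : K) : OnePoint K := if b = 0 then OnePoint.infty else ((a / b : K) : OnePoint K)

@[simp]
lemma ratio_zero_right (a : K) : ratio a 0 = OnePoint.infty := by simp [ratio]

lemma ratio_of_ne_zero (a : K) {b : K} (hb : b ≠ 0) : ratio a b = ((a / b : K) : OnePoint K) := by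
  simp [ratio, hb]

@[simp]
lemma ratio_one_right (a : K) : ratio a 1 = (a : OnePoint K) := by simp [ratio]

lemma ratio_mul_right (a b : K) {h : K} (hh : h ≠ 0) : ratio (a * h) (b * h) = ratio a b := by
  by_cases hb : b = 0
  · simp [hb]
  · rw [ratio_of_ne_zero _ (mul_ne_zero hb hh), ratio_of_ne_zero _ hb, mul_div_mul_right _ _ hh]

lemma ratio_eq_infty_iff {a b : K} : ratio a b = OnePoint.infty ↔ b = 0 := by
  by_cases hb : b = 0 <;> simp [ratio, hb]

lemma ratio_eq_coe_iff {a b y : K} (h : a ≠ 0 ∨ b ≠ 0) :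
    ratio a b = (y : OnePoint K) ↔ a = y * b := by
  by_cases hb : b = 0
  · subst hb
    simpa using h
  · rw [ratio_of_ne_zero _ hb, OnePoint.coe_eq_coe, div_eq_iff hb]

lemma exists_eq_ratio (P : OnePoint K) : ∃ a b : K, (a ≠ 0 ∨ b ≠ 0) ∧ P = ratio a b := by
  cases P with
  | infty => exact ⟨1, 0, by simp, by simp⟩
  | coe x => exact ⟨x, 1, by simp, by simp⟩

lemma smul_ratio [DecidableEq K] (g : GL (Fin 2) K) {a b : K} (h : a ≠ 0 ∨ b ≠ 0) :
    g • ratio a b = ratio (g 0 0 * a + g 0 1 * b) (g 1 0 * a + g 1 1 * b) := by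
  by_cases hb : b = 0
  · subst hb
    have ha : a ≠ 0 := by simpa using h
    rw [ratio_zero_right, OnePoint.smul_infty_eq_ite]
    simp only [mul_zero, add_zero]
    rw [ratio_mul_right _ _ ha]
    simp [ratio]
  · rw [ratio_of_ne_zero _ hb, OnePoint.smul_some_eq_ite,
      ← ratio_mul_right (g 0 0 * a + g 0 1 * b) _ (inv_ne_zero hb)]
    have h1 : (g 0 0 * a + g 0 1 * b) * b⁻¹ = g 0 0 * (a / b) + g 0 1 := by field_simp
    have h2 : (g 1 0 * a + g 1 1 * b) * b⁻¹ = g 1 0 * (a / b) + g 1 1 := by field_simp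
    rw [h1, h2, ratio]
    congr 1

lemma smul_coords_ne_zero (g : GL (Fin 2) K) {a b : K} (h : a ≠ 0 ∨ b ≠ 0) :
    g 0 0 * a + g 0 1 * b ≠ 0 ∨ g 1 0 * a + g 1 1 * b ≠ 0 := by
  by_contra! hc
  have hdet := g.det_ne_zero
  rw [Matrix.det_fin_two] at hdet
  obtain ⟨h1, h2⟩ := hc
  have ha : (g 0 0 * g 1 1 - g 0 1 * g 1 0) * a = 0 := by linear_combination g 1 1 * h1 - g 0 1 * h2
  have hb : (g 0 0 * g 1 1 - g 0 1 * g 1 0) * b = 0 := by linear_combination g 0 0 * h2 - g 1 0 * h1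
  simp_all

end ProjectiveCoordinates

/-! ### The point map of a rational function -/

section ToMap

variable {K : Type*} [Field K]

lemma toMap_coe (φ : RatFunc K) (x : K) :
    toMap φ (x : OnePoint K) = ratio (φ.num.eval x) (φ.denom.eval x) := rfl

lemma toMap_infty (φ : RatFunc K) :
    toMap φ OnePoint.infty = ratio (φ.num.coeff (deg φ)) (φ.denom.coeff (deg φ)) := rfl

lemma coeff_deg_ne_zero (φ : RatFunc K) :
    φ.num.coeff (deg φ) ≠ 0 ∨ φ.denom.coeff (deg φ) ≠ 0 := by
  by_cases h0 : φ = 0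
  · simp [h0, deg]
  rcases max_choice φ.num.natDegree φ.denom.natDegree with h | h
  · left
    rw [deg, h, coeff_natDegree]
    exact leadingCoeff_ne_zero.2 (RatFunc.num_ne_zero h0)
  · right
    rw [deg, h, coeff_natDegree]
    exact leadingCoeff_ne_zero.2 φ.denom_ne_zero

lemma eval_ne_zero (φ : RatFunc K) (x : K) : φ.num.eval x ≠ 0 ∨ φ.denom.eval x ≠ 0 := by
  by_contra! h
  obtain ⟨u, v, huv⟩ := φ.isCoprime_num_denom
  have := congrArg (eval x) huv
  simp [h.1, h.2] at this

lemma natDegree_num_le (φ : RatFunc K) : φ.num.natDegree ≤ deg φ := le_max_left _ _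

lemma natDegree_denom_le (φ : RatFunc K) : φ.denom.natDegree ≤ deg φ := le_max_right _ _

lemma exists_eq_num_mul {φ : RatFunc K} {p q : K[X]} (hq : q ≠ 0)
    (hφ : φ = algebraMap _ _ p / algebraMap _ _ q) :
    ∃ h, h ≠ 0 ∧ p = φ.num * h ∧ q = φ.denom * h := by
  have h1 := (RatFunc.num_mul_eq_mul_denom_iff hq).2 hφ
  have h2 : φ.denom ∣ q := (RatFunc.denom_dvd hq).2 ⟨p, hφ⟩
  obtain ⟨h, rfl⟩ := h2
  refine ⟨h, right_ne_zero_of_mul hq, ?_, rfl⟩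
  apply mul_right_cancel₀ φ.denom_ne_zero
  rw [← h1]
  ring

lemma toMap_coe_of_eq_div {φ : RatFunc K} {p q : K[X]} (hq : q ≠ 0)
    (hφ : φ = algebraMap _ _ p / algebraMap _ _ q) {x : K} (hx : p.eval x ≠ 0 ∨ q.eval x ≠ 0) :
    toMap φ (x : OnePoint K) = ratio (p.eval x) (q.eval x) := by
  obtain ⟨h, -, rfl, rfl⟩ := exists_eq_num_mul hq hφ
  rw [eval_mul, eval_mul] at *
  rw [ratio_mul_right _ _ (by rintro h0; simp [h0] at hx), toMap_coe]

lemma deg_add_natDegree (φ : RatFunc K) {h : K[X]} (hh : h ≠ 0) :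
    deg φ + h.natDegree = max (φ.num * h).natDegree (φ.denom * h).natDegree := by
  by_cases h0 : φ = 0
  · simp [h0, deg]
  · rw [natDegree_mul (RatFunc.num_ne_zero h0) hh, natDegree_mul φ.denom_ne_zero hh, deg]
    omega

/-- The fraction need not be in lowest terms: a common factor h only rescales the homogeneous
coordinates, and the hypothesis on N forces N = `deg φ + h.natDegree`. -/
lemma toMap_infty_of_eq_div {φ : RatFunc K} {p q : K[X]} (hq : q ≠ 0)
    (hφ : φ = algebraMap _ _ p / algebraMap _ _ q) {N : ℕ} (hp : p.natDegree ≤ N)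
    (hqN : q.natDegree ≤ N) (hN : p.coeff N ≠ 0 ∨ q.coeff N ≠ 0) :
    toMap φ OnePoint.infty = ratio (p.coeff N) (q.coeff N) := by
  obtain ⟨h, hh, rfl, rfl⟩ := exists_eq_num_mul hq hφ
  have hd := deg_add_natDegree φ hh
  have : N = deg φ + h.natDegree := by
    have : N ≤ (φ.num * h).natDegree ∨ N ≤ (φ.denom * h).natDegree :=
      hN.imp le_natDegree_of_ne_zero le_natDegree_of_ne_zero
    omega
  subst this
  rw [coeff_mul_add_eq_of_natDegree_le (natDegree_num_le φ) le_rfl,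
    coeff_mul_add_eq_of_natDegree_le (natDegree_denom_le φ) le_rfl, ratio_mul_right, toMap_infty]
  simpa using hh

lemma deg_le_of_eq_div {φ : RatFunc K} {p q : K[X]} (hq : q ≠ 0)
    (hφ : φ = algebraMap _ _ p / algebraMap _ _ q) {N : ℕ} (hp : p.natDegree ≤ N)
    (hqN : q.natDegree ≤ N) : deg φ ≤ N := by
  obtain ⟨h, hh, rfl, rfl⟩ := exists_eq_num_mul hq hφ
  have hd := deg_add_natDegree φ hh
  omega

/-- The cross-multiplied identity holds at every point of an infinite field, hence as polynomials.
This reduces identities between compositions to pointwise ones. -/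
lemma toMap_injective [Infinite K] : Function.Injective (toMap : RatFunc K → _) := by
  intro φ ψ h
  have key : φ.num * ψ.denom = ψ.num * φ.denom := by
    refine funext fun x => ?_
    have hx := congrFun h (x : OnePoint K)
    rw [toMap_coe, toMap_coe] at hx
    simp only [eval_mul]
    by_cases h0 : ψ.denom.eval x = 0
    · rw [h0, ratio_zero_right, ratio_eq_infty_iff] at hx
      simp [h0, hx]
    · rw [ratio_of_ne_zero _ h0, ratio_eq_coe_iff (eval_ne_zero φ x)] at hx
      rw [hx]
      field_simp
  rw [RatFunc.num_mul_eq_mul_denom_iff ψ.denom_ne_zero] at key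
  rw [key, RatFunc.num_div_denom]

@[simp]
lemma toMap_X : toMap (RatFunc.X : RatFunc K) = id := by
  funext P
  cases P with
  | infty => simp [toMap_infty, deg, coeff_one]
  | coe x => simp [toMap_coe]

lemma toMap_C (c : K) (P : OnePoint K) : toMap (RatFunc.C c) P = c := by
  cases P with
  | infty => simp [toMap_infty, deg]
  | coe x => simp [toMap_coe]

lemma exists_eq_C_of_deg_eq_zero {φ : RatFunc K} (h : deg φ = 0) : ∃ c, φ = RatFunc.C c := by
  have h1 : φ.num.natDegree = 0 := by have := natDegree_num_le φ; omega
  have h2 : φ.denom.natDegree = 0 := by have := natDegree_denom_le φ; omega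
  obtain ⟨c, hc⟩ := natDegree_eq_zero.1 h1
  have h3 : φ.denom = 1 := φ.monic_denom.natDegree_eq_zero.1 h2
  refine ⟨c, ?_⟩
  rw [← φ.num_div_denom, h3, ← hc]
  simp

lemma deg_C (c : K) : deg (RatFunc.C c) = 0 := by simp [deg]

lemma ne_C_of_deg_pos {φ : RatFunc K} (h : 0 < deg φ) : ¬ ∃ c, φ = RatFunc.C c := by
  rintro ⟨c, rfl⟩
  simp [deg_C] at h

end ToMap

/-! ### Composition corresponds to composition of point maps -/

section Composition

variable {K : Type*} [Field K]

/-- The value at `(a, b)` of the form of degree `n` whose dehomogenization is `p`. -/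
def homEval {A : Type*} [CommRing A] [Algebra K A] (n : ℕ) (p : K[X]) (a b : A) : A :=
  ∑ i ∈ Finset.range (n + 1), p.coeff i • (a ^ i * b ^ (n - i))

lemma map_homEval {A B : Type*} [CommRing A] [Algebra K A] [CommRing B] [Algebra K B]
    (f : A →ₐ[K] B) (n : ℕ) (p : K[X]) (a b : A) :
    f (homEval n p a b) = homEval n p (f a) (f b) := by
  simp [homEval]

lemma homEval_eq_mul_aeval {L : Type*} [Field L] [Algebra K L] {n : ℕ} {p : K[X]}
    (hp : p.natDegree ≤ n) (a : L) {b : L} (hb : b ≠ 0) :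
    homEval n p a b = b ^ n * aeval (a / b) p := by
  rw [aeval_eq_sum_range' (Nat.lt_succ_of_le hp), homEval, Finset.mul_sum]
  refine Finset.sum_congr rfl fun i hi => ?_
  have hi : i ≤ n := by simpa [Nat.lt_succ_iff] using hi
  obtain ⟨k, rfl⟩ := Nat.exists_eq_add_of_le hi
  rw [Nat.add_sub_cancel_left, mul_smul_comm]
  congr 1
  rw [pow_add, div_pow]
  field_simp

lemma homEval_zero_right (n : ℕ) (p : K[X]) (a : K) : homEval n p a 0 = p.coeff n * a ^ n := by
  rw [homEval, Finset.sum_eq_single n]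
  · simp
  · intro i hi hin
    have : n - i ≠ 0 := by simp at hi; omega
    simp [this]
  · simp

lemma natDegree_homEval_le {n m : ℕ} (p : K[X]) {r s : K[X]} (hr : r.natDegree ≤ m)
    (hs : s.natDegree ≤ m) : (homEval n p r s).natDegree ≤ n * m := by
  refine natDegree_sum_le_of_forall_le _ _ fun i hi => ?_
  have hi : i ≤ n := by simpa [Nat.lt_succ_iff] using hi
  obtain ⟨k, rfl⟩ := Nat.exists_eq_add_of_le hi
  refine (natDegree_smul_le _ _).trans (natDegree_mul_le.trans ?_)
  rw [Nat.add_sub_cancel_left, add_mul]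
  exact add_le_add (natDegree_pow_le_of_le _ hr) (natDegree_pow_le_of_le _ hs)

lemma coeff_homEval {n m : ℕ} (p : K[X]) {r s : K[X]} (hr : r.natDegree ≤ m)
    (hs : s.natDegree ≤ m) :
    (homEval n p r s).coeff (n * m) = homEval n p (r.coeff m) (s.coeff m) := by
  simp only [homEval, finsetSum_coeff, coeff_smul]
  refine Finset.sum_congr rfl fun i hi => ?_
  have hi : i ≤ n := by simpa [Nat.lt_succ_iff] using hi
  obtain ⟨k, rfl⟩ := Nat.exists_eq_add_of_le hi
  rw [Nat.add_sub_cancel_left, add_mul, coeff_mul_add_eq_of_natDegree_le (natDegree_pow_le_of_le _ hr)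
    (natDegree_pow_le_of_le _ hs), coeff_pow_of_natDegree_le hr, coeff_pow_of_natDegree_le hs]

lemma toMap_ratio (φ : RatFunc K) {a b : K} (h : a ≠ 0 ∨ b ≠ 0) :
    (homEval (deg φ) φ.num a b ≠ 0 ∨ homEval (deg φ) φ.denom a b ≠ 0) ∧
    toMap φ (ratio a b) =
      ratio (homEval (deg φ) φ.num a b) (homEval (deg φ) φ.denom a b) := by
  by_cases hb : b = 0
  · subst hb
    have ha : a ^ deg φ ≠ 0 := pow_ne_zero _ (by simpa using h)
    simp only [homEval_zero_right, ratio_zero_right, ratio_mul_right _ _ ha]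
    exact ⟨(coeff_deg_ne_zero φ).imp (mul_ne_zero · ha) (mul_ne_zero · ha), toMap_infty φ⟩
  · have hb' : b ^ deg φ ≠ 0 := pow_ne_zero _ hb
    rw [homEval_eq_mul_aeval (natDegree_num_le φ) _ hb,
      homEval_eq_mul_aeval (natDegree_denom_le φ) _ hb, mul_comm, mul_comm (b ^ deg φ),
      ratio_mul_right _ _ hb', ratio_of_ne_zero _ hb, toMap_coe]
    simp only [coe_aeval_eq_eval, and_true]
    exact (eval_ne_zero φ _).imp (mul_ne_zero · hb') (mul_ne_zero · hb')

/-- Multiplying numerator and denominator of φ(ψ) by `ψ.denom ^ deg φ` homogenises them. The new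
denominator is nonzero because a nonconstant ψ is transcendental over K. -/
lemma comp_eq_div (φ : RatFunc K) {ψ : RatFunc K} (hψ : 0 < deg ψ) :
    homEval (deg φ) φ.denom ψ.num ψ.denom ≠ 0 ∧
    comp φ ψ = algebraMap _ _ (homEval (deg φ) φ.num ψ.num ψ.denom) /
      algebraMap _ _ (homEval (deg φ) φ.denom ψ.num ψ.denom) := by
  have hs : algebraMap K[X] (RatFunc K) ψ.denom ≠ 0 := by simpa using ψ.denom_ne_zero
  have key : ∀ p : K[X], p.natDegree ≤ deg φ →
      algebraMap K[X] (RatFunc K) (homEval (deg φ) p ψ.num ψ.denom) =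
        algebraMap K[X] (RatFunc K) ψ.denom ^ deg φ * aeval ψ p := by
    intro p hp
    have := map_homEval (IsScalarTower.toAlgHom K K[X] (RatFunc K)) (deg φ) p ψ.num ψ.denom
    simp only [IsScalarTower.coe_toAlgHom'] at this
    rw [this, homEval_eq_mul_aeval hp _ hs, RatFunc.num_div_denom]
  have htr := RatFunc.transcendental_of_ne_C ψ (ne_C_of_deg_pos hψ)
  constructor
  · intro h0
    have := key _ (natDegree_denom_le φ)
    rw [h0, map_zero, eq_comm, mul_eq_zero] at this
    exact htr ⟨_, φ.denom_ne_zero, this.resolve_left (pow_ne_zero _ hs)⟩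
  · rw [key _ (natDegree_denom_le φ), key _ (natDegree_num_le φ),
      mul_div_mul_left _ _ (pow_ne_zero _ hs)]
    rfl

lemma toMap_comp (φ : RatFunc K) {ψ : RatFunc K} (hψ : 0 < deg ψ) :
    toMap (comp φ ψ) = toMap φ ∘ toMap ψ := by
  obtain ⟨hq, hc⟩ := comp_eq_div φ hψ
  funext P
  cases P with
  | infty =>
    obtain ⟨h1, h2⟩ := toMap_ratio φ (coeff_deg_ne_zero ψ)
    rw [← coeff_homEval _ (natDegree_num_le ψ) (natDegree_denom_le ψ),
      ← coeff_homEval _ (natDegree_num_le ψ) (natDegree_denom_le ψ)] at h1 h2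
    rw [toMap_infty_of_eq_div hq hc
      (natDegree_homEval_le _ (natDegree_num_le ψ) (natDegree_denom_le ψ))
      (natDegree_homEval_le _ (natDegree_num_le ψ) (natDegree_denom_le ψ)) h1, ← h2,
      Function.comp_apply, toMap_infty]
  | coe x =>
    obtain ⟨h1, h2⟩ := toMap_ratio φ (eval_ne_zero ψ x)
    have h3 : ∀ p : K[X], (homEval (deg φ) p ψ.num ψ.denom).eval x =
        homEval (deg φ) p (ψ.num.eval x) (ψ.denom.eval x) := fun p => by
      simpa using map_homEval (aeval x : K[X] →ₐ[K] K) (deg φ) p ψ.num ψ.denom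
    rw [← h3, ← h3] at h1 h2
    rw [toMap_coe_of_eq_div hq hc h1, ← h2, Function.comp_apply, toMap_coe]

lemma deg_comp_le (φ : RatFunc K) {ψ : RatFunc K} (hψ : 0 < deg ψ) :
    deg (comp φ ψ) ≤ deg φ * deg ψ := by
  obtain ⟨hq, hc⟩ := comp_eq_div φ hψ
  exact deg_le_of_eq_div hq hc
      (natDegree_homEval_le _ (natDegree_num_le ψ) (natDegree_denom_le ψ))
      (natDegree_homEval_le _ (natDegree_num_le ψ) (natDegree_denom_le ψ))

end Composition

/-! ### Rational functions of degree one as invertible matrices -/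

section Mobius

variable {K : Type*} [Field K] [DecidableEq K]

/-- The rational function of degree one attached to an invertible matrix. -/
def mobius (g : GL (Fin 2) K) : RatFunc K :=
  algebraMap K[X] _ (C (g 0 0) * X + C (g 0 1)) / algebraMap K[X] _ (C (g 1 0) * X + C (g 1 1))

omit [DecidableEq K] in
lemma mobius_denom_ne_zero (g : GL (Fin 2) K) : (C (g 1 0) * X + C (g 1 1) : K[X]) ≠ 0 := by
  intro h
  have h0 := congrArg (coeff · 0) h
  have h1 := congrArg (coeff · 1) h
  simp at h0 h1
  have := g.det_ne_zero
  rw [Matrix.det_fin_two] at this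
  simp [h0, h1] at this

omit [DecidableEq K] in
lemma mobius_def (g : GL (Fin 2) K) : mobius g = algebraMap K[X] _ (C (g 0 0) * X + C (g 0 1)) /
    algebraMap K[X] _ (C (g 1 0) * X + C (g 1 1)) := rfl

lemma toMap_mobius (g : GL (Fin 2) K) (P : OnePoint K) : toMap (mobius g) P = g • P := by
  cases P with
  | infty =>
    have h := smul_ratio g (a := 1) (b := 0) (by simp)
    have h' := smul_coords_ne_zero g (a := 1) (b := 0) (by simp)
    rw [toMap_infty_of_eq_div (mobius_denom_ne_zero g) (mobius_def g) (N := 1) (natDegree_linear_le)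
      (natDegree_linear_le) (by simpa using h')]
    simp at h ⊢
    exact h.symm
  | coe x =>
    have h := smul_ratio g (a := x) (b := 1) (by simp)
    have h' := smul_coords_ne_zero g (a := x) (b := 1) (by simp)
    rw [toMap_coe_of_eq_div (mobius_denom_ne_zero g) (mobius_def g) (by simpa using h')]
    simp at h ⊢
    exact h.symm

lemma deg_mobius [Infinite K] (g : GL (Fin 2) K) : deg (mobius g) = 1 := by
  have h1 : deg (mobius g) ≤ 1 := deg_le_of_eq_div (mobius_denom_ne_zero g) rfl
    natDegree_linear_le natDegree_linear_le
  have h2 : deg (mobius g) ≠ 0 := by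
    intro h0
    obtain ⟨c, hc⟩ := exists_eq_C_of_deg_eq_zero h0
    have : g • (OnePoint.infty : OnePoint K) = g • ((0 : K) : OnePoint K) := by
      rw [← toMap_mobius, ← toMap_mobius, hc, toMap_C, toMap_C]
    simp at this
  omega

lemma exists_smul_eq_toMap {σ : RatFunc K} (hσ : deg σ = 1) :
    ∃ g : GL (Fin 2) K, ∀ P, toMap σ P = g • P := by
  have hp := (natDegree_num_le σ).trans_eq hσ
  have hq := (natDegree_denom_le σ).trans_eq hσ
  obtain ⟨a, b, hab⟩ := exists_eq_X_add_C_of_natDegree_le_one hp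
  obtain ⟨c, d, hcd⟩ := exists_eq_X_add_C_of_natDegree_le_one hq
  have hcoeff := coeff_deg_ne_zero σ
  have hev := eval_ne_zero σ
  -- A vanishing determinant would make -d/c a common root when c ≠ 0, against coprimality; when c =
  -- 0, it would lower the degree or kill the denominator.
  have hdet : a * d - b * c ≠ 0 := by
    intro h0
    by_cases hc : c = 0
    · subst hc
      have hd : d ≠ 0 := by
        rintro rfl
        exact σ.denom_ne_zero (by simp [hcd])
      simp [hσ, hab, hcd] at hcoeff
      simp [hd, hcoeff] at h0
    · have := hev (-d / c)
      rw [hab, hcd] at this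
      simp at this
      rcases this with h | h
      · apply h
        field_simp
        linear_combination -h0
      · apply h
        field_simp
        ring
  let g : GL (Fin 2) K := Matrix.GeneralLinearGroup.mkOfDetNeZero !![a, b; c, d]
    (by rwa [Matrix.det_fin_two_of])
  have hg : σ = mobius g := by
    rw [← σ.num_div_denom, hab, hcd]
    simp [mobius, g, Matrix.GeneralLinearGroup.mkOfDetNeZero]
  exact ⟨g, fun P => by rw [hg, toMap_mobius]⟩

end Mobius

/-! ### Conjugacy classes in terms of point maps -/

section Conjugacy

variable {K : Type*} [Field K] [DecidableEq K]

/-- The self-maps `f` and `g` of the projective line are conjugate by a Möbius transformation. -/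
def MapConj (f g : OnePoint K → OnePoint K) : Prop :=
  ∃ γ : GL (Fin 2) K, ∀ P, γ • g P = f (γ • P)

lemma MapConj.refl (f : OnePoint K → OnePoint K) : MapConj f f := ⟨1, by simp⟩

lemma MapConj.symm {f g : OnePoint K → OnePoint K} (h : MapConj f g) : MapConj g f := by
  obtain ⟨γ, h⟩ := h
  refine ⟨γ⁻¹, fun P => ?_⟩
  rw [inv_smul_eq_iff, h, smul_inv_smul]

lemma MapConj.trans {f g h : OnePoint K → OnePoint K} (h₁ : MapConj f g) (h₂ : MapConj g h) :
    MapConj f h := by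
  obtain ⟨γ, h₁⟩ := h₁
  obtain ⟨δ, h₂⟩ := h₂
  exact ⟨γ * δ, fun P => by rw [mul_smul, mul_smul, h₂, h₁]⟩

variable [Infinite K]

omit [DecidableEq K] in
lemma deg_pos_iff {φ : RatFunc K} : 0 < deg φ ↔ ∃ P Q, toMap φ P ≠ toMap φ Q := by
  constructor
  · intro hφ
    by_contra! h
    cases h0 : toMap φ OnePoint.infty with
    | infty =>
      refine φ.denom_ne_zero (funext fun x => ?_)
      have := h x OnePoint.infty
      rw [h0, toMap_coe, ratio_eq_infty_iff] at this
      simpa using this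
    | coe c =>
      refine ne_C_of_deg_pos hφ ⟨c, toMap_injective ?_⟩
      funext P
      rw [h P OnePoint.infty, h0, toMap_C]
  · rintro ⟨P, Q, hPQ⟩
    by_contra! h0
    obtain ⟨c, rfl⟩ := exists_eq_C_of_deg_eq_zero (Nat.le_zero.1 h0)
    exact hPQ (by rw [toMap_C, toMap_C])

lemma deg_comp_pos {φ σ : RatFunc K} (hφ : 0 < deg φ) (hσ : deg σ = 1) :
    0 < deg (comp φ σ) := by
  obtain ⟨P, Q, hPQ⟩ := deg_pos_iff.1 hφ
  obtain ⟨g, hg⟩ := exists_smul_eq_toMap hσ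
  refine deg_pos_iff.2 ⟨g⁻¹ • P, g⁻¹ • Q, ?_⟩
  rw [toMap_comp _ (by omega)]
  simpa [hg] using hPQ

lemma isConjBy_mobius {φ ψ : RatFunc K} (hφ : 0 < deg φ) {g : GL (Fin 2) K}
    (h : ∀ P, g • toMap ψ P = toMap φ (g • P)) : IsConjBy (mobius g) φ ψ := by
  have key : ∀ g : GL (Fin 2) K, comp (mobius g) (mobius g⁻¹) = RatFunc.X := fun g => by
    apply toMap_injective
    rw [toMap_comp _ (by simp [deg_mobius])]
    funext P
    simp [toMap_mobius]
  refine ⟨deg_mobius g, mobius g⁻¹, deg_mobius _, key g, by simpa using key g⁻¹, ?_⟩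
  apply toMap_injective
  rw [toMap_comp _ (deg_comp_pos hφ (deg_mobius g)), toMap_comp _ (by simp [deg_mobius])]
  funext P
  simp only [Function.comp_apply, toMap_mobius]
  rw [← h, inv_smul_smul]

lemma IsConjBy.exists_smul {σ φ ψ : RatFunc K} (hφ : 0 < deg φ) (h : IsConjBy σ φ ψ) :
    ∃ g : GL (Fin 2) K, σ = mobius g ∧ ∀ P, g • toMap ψ P = toMap φ (g • P) := by
  obtain ⟨hσ, τ, hτ, h1, -, rfl⟩ := h
  obtain ⟨g, hg⟩ := exists_smul_eq_toMap hσ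
  refine ⟨g, toMap_injective (by funext P; rw [hg, toMap_mobius]), fun P => ?_⟩
  have hστ := toMap_comp σ (ψ := τ) (by rw [hτ]; norm_num)
  rw [h1, toMap_X] at hστ
  rw [toMap_comp _ (deg_comp_pos hφ hσ), toMap_comp _ (by rw [hσ]; norm_num), ← hg, ← hg]
  exact (congrFun hστ _).symm

lemma mem_conjClass_iff {φ ψ : RatFunc K} (hφ : 0 < deg φ) :
    ψ ∈ conjClass φ ↔ MapConj (toMap φ) (toMap ψ) := by
  constructor
  · rintro ⟨σ, h⟩
    obtain ⟨g, -, hg⟩ := h.exists_smul hφ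
    exact ⟨g, hg⟩
  · rintro ⟨g, hg⟩
    exact ⟨_, isConjBy_mobius hφ hg⟩

lemma conjClass_eq_iff {φ ψ : RatFunc K} (hφ : 0 < deg φ) (hψ : 0 < deg ψ) :
    conjClass φ = conjClass ψ ↔ MapConj (toMap φ) (toMap ψ) := by
  constructor
  · intro h
    rw [← mem_conjClass_iff hφ, h, mem_conjClass_iff hψ]
    exact .refl _
  · intro h
    ext χ
    rw [mem_conjClass_iff hφ, mem_conjClass_iff hψ]
    exact ⟨h.symm.trans, h.trans⟩

lemma IsConjBy.deg_le {σ φ ψ : RatFunc K} (hφ : 0 < deg φ) (h : IsConjBy σ φ ψ) :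
    deg ψ ≤ deg φ := by
  obtain ⟨hσ, τ, hτ, -, -, rfl⟩ := h
  calc _ ≤ deg τ * deg (comp φ σ) := deg_comp_le _ (deg_comp_pos hφ hσ)
    _ = deg (comp φ σ) := by rw [hτ, one_mul]
    _ ≤ deg φ * deg σ := deg_comp_le _ (by rw [hσ]; norm_num)
    _ = deg φ := by rw [hσ, mul_one]

/-- Conjugation never raises the degree; applying this to g and to g⁻¹ gives equality. -/
lemma exists_conj {φ : RatFunc K} (hφ : 0 < deg φ) (g : GL (Fin 2) K) :
    ∃ ψ : RatFunc K, deg ψ = deg φ ∧ ∀ P, g • toMap ψ P = toMap φ (g • P) := by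
  set ψ := comp (mobius g⁻¹) (comp φ (mobius g)) with hψ
  have h : ∀ P, g • toMap ψ P = toMap φ (g • P) := fun P => by
    rw [hψ, toMap_comp _ (deg_comp_pos hφ (deg_mobius g)), toMap_comp _ (by simp [deg_mobius])]
    simp [toMap_mobius]
  have hψ' : 0 < deg ψ := by
    obtain ⟨P, Q, hPQ⟩ := deg_pos_iff.1 hφ
    refine deg_pos_iff.2 ⟨g⁻¹ • P, g⁻¹ • Q, fun h' => hPQ ?_⟩
    have := congrArg (g • ·) h'
    simpa [h] using this
  have h' : ∀ P, g⁻¹ • toMap φ P = toMap ψ (g⁻¹ • P) := fun P => by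
    rw [inv_smul_eq_iff, h, smul_inv_smul]
  exact ⟨ψ, le_antisymm ((isConjBy_mobius hφ h).deg_le hφ)
    ((isConjBy_mobius hψ' h').deg_le hψ'), h⟩

end Conjugacy

/-! ### Fibres and critical points -/

section Critical

variable {K : Type*} [Field K]

lemma toMap_coe_eq_iff {φ : RatFunc K} {x : K} {Q : OnePoint K} :
    toMap φ (x : OnePoint K) = Q ↔ (fiberPoly φ Q).eval x = 0 := by
  rw [toMap_coe]
  cases Q with
  | infty => exact ratio_eq_infty_iff
  | coe y =>
    rw [ratio_eq_coe_iff (eval_ne_zero φ x)]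
    change _ ↔ (φ.num - C y * φ.denom).eval x = 0
    simp [sub_eq_zero]

lemma toMap_infty_eq_iff {φ : RatFunc K} {Q : OnePoint K} :
    toMap φ OnePoint.infty = Q ↔ (fiberPoly φ Q).coeff (deg φ) = 0 := by
  rw [toMap_infty]
  cases Q with
  | infty => exact ratio_eq_infty_iff
  | coe y =>
    rw [ratio_eq_coe_iff (coeff_deg_ne_zero φ)]
    change _ ↔ (φ.num - C y * φ.denom).coeff (deg φ) = 0
    simp [sub_eq_zero]

lemma natDegree_fiberPoly_le (φ : RatFunc K) (Q : OnePoint K) :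
    (fiberPoly φ Q).natDegree ≤ deg φ := by
  cases Q with
  | infty => exact natDegree_denom_le φ
  | coe y =>
    exact (natDegree_sub_le _ _).trans (max_le (natDegree_num_le φ)
      ((natDegree_C_mul_le _ _).trans (natDegree_denom_le φ)))

lemma fiberPoly_ne_zero [Infinite K] {φ : RatFunc K} (hφ : 0 < deg φ) (Q : OnePoint K) :
    fiberPoly φ Q ≠ 0 := by
  intro h0
  obtain ⟨P, P', h⟩ := deg_pos_iff.1 hφ
  have : ∀ P, toMap φ P = Q := fun P => by
    cases P with
    | infty => simp [toMap_infty_eq_iff, h0]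
    | coe x => simp [toMap_coe_eq_iff, h0]
  exact h (by rw [this, this])

/-- For a quadratic map, a critical point is alone in its fibre. -/
lemma IsCriticalPoint.eq_of_toMap_eq [Infinite K] {φ : RatFunc K} (hφ : deg φ = 2)
    {P : OnePoint K} (hP : IsCriticalPoint φ P) {Q : OnePoint K} (h : toMap φ Q = toMap φ P) :
    Q = P := by
  have hF := fiberPoly_ne_zero (φ := φ) (by omega) (toMap φ P)
  have hd := natDegree_fiberPoly_le φ (toMap φ P)
  rw [hφ] at hd
  cases P with
  | infty =>
    change 1 < deg φ - (fiberPoly φ (toMap φ OnePoint.infty)).natDegree at hP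
    obtain ⟨c, hc⟩ := natDegree_eq_zero.1
      (show (fiberPoly φ (toMap φ OnePoint.infty)).natDegree = 0 by omega)
    cases Q with
    | infty => rfl
    | coe x =>
      rw [toMap_coe_eq_iff, ← hc, eval_C] at h
      rw [← hc, h] at hF
      simp at hF
  | coe x =>
    change 1 < (fiberPoly φ (toMap φ x)).rootMultiplicity x at hP
    have hdvd := (le_rootMultiplicity_iff hF).1 (show 2 ≤ _ from hP)
    obtain ⟨r, hr⟩ := hdvd
    rw [hr] at hF hd
    have hr0 : r ≠ 0 := right_ne_zero_of_mul hF
    have hm : ((X - C x) ^ 2 : K[X]).Monic := (monic_X_sub_C x).pow 2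
    rw [hm.natDegree_mul' hr0, natDegree_pow, natDegree_X_sub_C] at hd
    -- The fibre polynomial is a constant times (X - x)², so the double point uses up the whole
    -- fibre, including any contribution at ∞.
    obtain ⟨c, rfl⟩ := natDegree_eq_zero.1 (show r.natDegree = 0 by omega)
    have hc : c ≠ 0 := by simpa using hr0
    cases Q with
    | infty =>
      rw [toMap_infty_eq_iff, hr, hφ, coeff_mul_C] at h
      have h2 : ((X - C x) ^ 2 : K[X]).coeff 2 = 1 := by
        have := hm.coeff_natDegree
        rwa [natDegree_pow, natDegree_X_sub_C] at this
      simp [h2, hc] at h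
    | coe y =>
      rw [toMap_coe_eq_iff, hr] at h
      simpa [hc, sub_eq_zero] using h

end Critical

/-! ### Transport of periods, and explicit Möbius transformations -/

section Transport

variable {K : Type*} [Field K] [DecidableEq K] {f g : OnePoint K → OnePoint K}
  {γ : GL (Fin 2) K}

lemma iterate_smul (h : ∀ P, γ • g P = f (γ • P)) (n : ℕ) (P : OnePoint K) :
    γ • g^[n] P = f^[n] (γ • P) := by
  induction n generalizing P with
  | zero => rfl
  | succ n ih => rw [Function.iterate_succ_apply, Function.iterate_succ_apply, ih, h]

lemma minimalPeriod_smul (h : ∀ P, γ • g P = f (γ • P)) (P : OnePoint K) :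
    Function.minimalPeriod f (γ • P) = Function.minimalPeriod g P := by
  rw [Function.minimalPeriod_eq_minimalPeriod_iff]
  intro n
  rw [Function.IsPeriodicPt, Function.IsFixedPt, ← iterate_smul h, smul_left_cancel_iff]
  rfl

/-- The Möbius transformation `x ↦ (a x + b) / (c x + d)`. -/
def gl (a b c d : K) (h : a * d - b * c ≠ 0) : GL (Fin 2) K :=
  Matrix.GeneralLinearGroup.mkOfDetNeZero !![a, b; c, d] (by rwa [Matrix.det_fin_two_of])

lemma gl_smul_coe {a b c d : K} (h : a * d - b * c ≠ 0) (x : K) :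
    gl a b c d h • (x : OnePoint K) = ratio (a * x + b) (c * x + d) := by
  rw [← ratio_one_right x, smul_ratio _ (by simp)]
  simp [gl, Matrix.GeneralLinearGroup.mkOfDetNeZero]

lemma gl_smul_infty {a b c d : K} (h : a * d - b * c ≠ 0) :
    gl a b c d h • (OnePoint.infty : OnePoint K) = ratio a c := by
  rw [← ratio_zero_right 1, smul_ratio _ (by simp)]
  simp [gl, Matrix.GeneralLinearGroup.mkOfDetNeZero]

lemma smul_coe_eq_coe_iff {x y : K} :
    γ • (x : OnePoint K) = y ↔ γ 0 0 * x + γ 0 1 = y * (γ 1 0 * x + γ 1 1) := by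
  rw [← ratio_one_right x, smul_ratio _ (by simp), ratio_eq_coe_iff (smul_coords_ne_zero _ (by simp))]
  simp

variable (K) in
/-- The Möbius transformation `x ↦ -x`. -/
def negGL : GL (Fin 2) K := gl (-1) 0 0 1 (by simp)

lemma negGL_smul_coe (x : K) : negGL K • (x : OnePoint K) = ((-x : K) : OnePoint K) := by
  simp [negGL, gl_smul_coe]

lemma negGL_smul_infty : negGL K • (OnePoint.infty : OnePoint K) = OnePoint.infty := by
  simp [negGL, gl_smul_infty]

end Transport

/-! ### The family `sym u` and the invariance of u -/

section SymmetricFamily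

variable {K : Type*} [Field K]

lemma num_denom_of_isCoprime {p q : K[X]} (hq : q.Monic) (h : IsCoprime p q) :
    (algebraMap K[X] (RatFunc K) p / algebraMap K[X] (RatFunc K) q).num = p ∧
    (algebraMap K[X] (RatFunc K) p / algebraMap K[X] (RatFunc K) q).denom = q := by
  set φ := algebraMap K[X] (RatFunc K) p / algebraMap K[X] (RatFunc K) q with hφ
  obtain ⟨r, -, hp, hq'⟩ := exists_eq_num_mul hq.ne_zero hφ
  have hr : IsUnit r := h.isUnit_of_dvd' ⟨φ.num, by rw [hp, mul_comm]⟩ ⟨φ.denom, by rw [hq', mul_comm]⟩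
  obtain ⟨c, -, rfl⟩ := isUnit_iff.1 hr
  have hc : c = 1 := by
    have := hq.leadingCoeff
    rw [hq', leadingCoeff_mul, φ.monic_denom.leadingCoeff] at this
    simpa using this
  subst hc
  simp at hp hq'
  exact ⟨hp.symm, hq'.symm⟩

/-- The quadratic map `x ↦ (u / 2) (x + 1 / x)`, which commutes with `x ↦ -x`, has the critical
points `1` and `-1`, and maps `1` to `u`. -/
def sym (u : K) : RatFunc K :=
  algebraMap K[X] _ (C (u / 2) * (X ^ 2 + 1)) / algebraMap K[X] _ X

variable [CharZero K] {u : K}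

lemma sym_num_denom (hu : u ≠ 0) :
    (sym u).num = C (u / 2) * (X ^ 2 + 1) ∧ (sym u).denom = X := by
  refine num_denom_of_isCoprime monic_X ⟨C (2 / u), -X, ?_⟩
  rw [← mul_assoc, ← C_mul, div_mul_div_cancel₀ hu, div_self two_ne_zero]
  simp
  ring

lemma deg_sym (hu : u ≠ 0) : deg (sym u) = 2 := by
  have h : (X ^ 2 + 1 : K[X]).natDegree = 2 := by
    simpa using natDegree_X_pow_add_C (n := 2) (r := (1 : K))
  rw [deg, (sym_num_denom hu).1, (sym_num_denom hu).2, natDegree_C_mul (by simpa), h]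
  simp

lemma toMap_sym_coe (hu : u ≠ 0) (x : K) :
    toMap (sym u) (x : OnePoint K) = ratio (u / 2 * (x ^ 2 + 1)) x := by
  rw [toMap_coe, (sym_num_denom hu).1, (sym_num_denom hu).2]
  simp

lemma toMap_sym_of_ne_zero (hu : u ≠ 0) {x : K} (hx : x ≠ 0) :
    toMap (sym u) (x : OnePoint K) = ((u / 2 * (x ^ 2 + 1) / x : K) : OnePoint K) := by
  rw [toMap_sym_coe hu, ratio_of_ne_zero _ hx]

lemma toMap_sym_infty (hu : u ≠ 0) : toMap (sym u) OnePoint.infty = OnePoint.infty := by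
  rw [toMap_infty, (sym_num_denom hu).1, (sym_num_denom hu).2, deg_sym hu, ratio_eq_infty_iff]
  simp [coeff_X]

lemma toMap_sym_zero (hu : u ≠ 0) : toMap (sym u) ((0 : K) : OnePoint K) = OnePoint.infty := by
  rw [toMap_sym_coe hu, ratio_zero_right]

lemma toMap_sym_one (hu : u ≠ 0) : toMap (sym u) ((1 : K) : OnePoint K) = u := by
  rw [toMap_sym_of_ne_zero hu one_ne_zero]
  congr 1
  ring

lemma toMap_sym_neg_one (hu : u ≠ 0) :
    toMap (sym u) ((-1 : K) : OnePoint K) = ((-u : K) : OnePoint K) := by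
  rw [toMap_sym_of_ne_zero hu (by simp)]
  congr 1
  ring

lemma isCriticalPoint_sym_one (hu : u ≠ 0) : IsCriticalPoint (sym u) ((1 : K) : OnePoint K) := by
  change 1 < (fiberPoly (sym u) (toMap (sym u) (1 : K))).rootMultiplicity 1
  have : fiberPoly (sym u) (u : OnePoint K) = (X - C 1) ^ 2 * C (u / 2) := by
    change (sym u).num - C u * (sym u).denom = _
    have : C u = C (u / 2) * 2 := by
      rw [← C_ofNat, ← C_mul]
      congr 1
      ring
    rw [(sym_num_denom hu).1, (sym_num_denom hu).2, this, C_1]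
    ring
  rw [toMap_sym_one hu]
  exact (le_rootMultiplicity_iff (fiberPoly_ne_zero (by rw [deg_sym hu]; norm_num) _)).2
    ⟨C (u / 2), this⟩

/-- The map takes equal values at x and 1/x, so a point alone in its fibre satisfies x = 1/x. Being
alone in its fibre is a purely set-theoretic trace of criticality, and so is visibly preserved by
conjugacy of point maps. -/
lemma eq_one_or_neg_one_of_fiber (hu : u ≠ 0) {P : OnePoint K}
    (hP : ∀ Q, toMap (sym u) Q = toMap (sym u) P → Q = P) :
    P = ((1 : K) : OnePoint K) ∨ P = ((-1 : K) : OnePoint K) := by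
  cases P with
  | infty =>
    have := hP ((0 : K) : OnePoint K) (by rw [toMap_sym_zero hu, toMap_sym_infty hu])
    simp at this
  | coe x =>
    have hx : x ≠ 0 := by
      rintro rfl
      have := hP OnePoint.infty (by rw [toMap_sym_zero hu, toMap_sym_infty hu])
      simp at this
    have := hP ((x⁻¹ : K) : OnePoint K) (by
      rw [toMap_sym_of_ne_zero hu hx, toMap_sym_of_ne_zero hu (inv_ne_zero hx)]
      congr 1
      field_simp
      ring)
    rw [OnePoint.coe_eq_coe] at this
    have h1 : x ^ 2 = 1 := by
      field_simp at this
      linear_combination -this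
    rw [OnePoint.coe_eq_coe, OnePoint.coe_eq_coe]
    exact mul_self_eq_one_iff.1 (by rw [← sq, h1])

variable [DecidableEq K]

lemma negGL_smul_toMap_sym (hu : u ≠ 0) (P : OnePoint K) :
    negGL K • toMap (sym u) P = toMap (sym u) (negGL K • P) := by
  cases P with
  | infty => simp [toMap_sym_infty hu, negGL_smul_infty]
  | coe x =>
    by_cases hx : x = 0
    · subst hx
      simp [toMap_sym_zero hu, negGL_smul_infty, negGL_smul_coe]
    · rw [toMap_sym_of_ne_zero hu hx, negGL_smul_coe, negGL_smul_coe,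
        toMap_sym_of_ne_zero hu (neg_ne_zero.2 hx)]
      congr 1
      field_simp

lemma minimalPeriod_sym_neg_one (hu : u ≠ 0) :
    Function.minimalPeriod (toMap (sym u)) ((-1 : K) : OnePoint K) =
      Function.minimalPeriod (toMap (sym u)) ((1 : K) : OnePoint K) := by
  rw [← negGL_smul_coe, minimalPeriod_smul (negGL_smul_toMap_sym hu)]

omit [DecidableEq K] in
lemma eq_one_of_toMap_sym_eq (hu : u ≠ 0) {Q : OnePoint K}
    (h : toMap (sym u) Q = toMap (sym u) ((1 : K) : OnePoint K)) : Q = ((1 : K) : OnePoint K) :=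
  (isCriticalPoint_sym_one hu).eq_of_toMap_eq (deg_sym hu) h

lemma eq_neg_one_of_toMap_sym_eq (hu : u ≠ 0) {Q : OnePoint K}
    (h : toMap (sym u) Q = toMap (sym u) ((-1 : K) : OnePoint K)) :
    Q = ((-1 : K) : OnePoint K) := by
  have h1 : negGL K • Q = ((1 : K) : OnePoint K) := by
    apply eq_one_of_toMap_sym_eq hu
    rw [← negGL_smul_toMap_sym hu, h, negGL_smul_toMap_sym hu, negGL_smul_coe, neg_neg]
  rw [← smul_left_cancel_iff (negGL K), h1, negGL_smul_coe, neg_neg]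

/-- The parameter `u` is an invariant of the conjugacy class of `sym u`. -/
lemma eq_of_mapConj_sym {v : K} (hu : u ≠ 0) (hv : v ≠ 0)
    (h : MapConj (toMap (sym u)) (toMap (sym v))) : u = v := by
  have hpt : ∀ {γ : GL (Fin 2) K} (_ : ∀ P, γ • toMap (sym v) P = toMap (sym u) (γ • P))
      {P : OnePoint K} (_ : ∀ Q, toMap (sym v) Q = toMap (sym v) P → Q = P),
      γ • P = ((1 : K) : OnePoint K) ∨ γ • P = ((-1 : K) : OnePoint K) := by
    intro γ h P hP
    refine eq_one_or_neg_one_of_fiber hu fun Q hQ => ?_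
    rw [← inv_smul_eq_iff]
    apply hP
    rw [← smul_left_cancel_iff γ, h, h, smul_inv_smul, hQ]
  -- The conjugating γ permutes ±1; composing it with the automorphism x ↦ -x if necessary, it fixes
  -- 1, and then also -1.
  obtain ⟨γ, h, h1⟩ : ∃ γ : GL (Fin 2) K,
      (∀ P, γ • toMap (sym v) P = toMap (sym u) (γ • P)) ∧
      γ • ((1 : K) : OnePoint K) = ((1 : K) : OnePoint K) := by
    obtain ⟨γ, h⟩ := h
    rcases hpt h fun Q => eq_one_of_toMap_sym_eq hv with h1 | h1
    · exact ⟨γ, h, h1⟩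
    · refine ⟨negGL K * γ, fun P => ?_, ?_⟩
      · rw [mul_smul, mul_smul, h, negGL_smul_toMap_sym hu]
      · rw [mul_smul, h1, negGL_smul_coe, neg_neg]
  have h2 : γ • ((-1 : K) : OnePoint K) = ((-1 : K) : OnePoint K) := by
    refine (hpt h fun Q => eq_neg_one_of_toMap_sym_eq hv).resolve_left fun h2 => ?_
    rw [← h1, smul_left_cancel_iff, OnePoint.coe_eq_coe] at h2
    norm_num at h2
  have h3 := h ((1 : K) : OnePoint K)
  have h4 := h ((-1 : K) : OnePoint K)
  have h5 := h OnePoint.infty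
  rw [h1, toMap_sym_one hu, toMap_sym_one hv, smul_coe_eq_coe_iff] at h3
  rw [h2, toMap_sym_neg_one hu, toMap_sym_neg_one hv, smul_coe_eq_coe_iff] at h4
  rw [smul_coe_eq_coe_iff] at h1 h2
  -- Fixing ±1 means γ = (ax + b)/(bx + a). Since γ also sends the critical values ±v to ±u, it
  -- follows that a(u - v) = 0.
  have hda : γ 1 1 = γ 0 0 := by linear_combination (h2 - h1) / 2
  have hcb : γ 1 0 = γ 0 1 := by linear_combination (-h2 - h1) / 2
  by_contra huv
  have ha : γ 0 0 = 0 := by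
    have : γ 0 0 * (u - v) = 0 := by rw [hda, hcb] at h3 h4; linear_combination (h4 - h3) / 2
    exact (mul_eq_zero.1 this).resolve_right (sub_ne_zero.2 huv)
  have hb : γ 1 0 ≠ 0 := by
    intro hb
    have := γ.det_ne_zero
    rw [Matrix.det_fin_two, ha, hb] at this
    simp at this
  -- If a = 0 then γ is x ↦ 1/x, which would carry the fixed point ∞ to 0; but 0 is not fixed.
  rw [toMap_sym_infty hv, OnePoint.smul_infty_eq_ite, if_neg hb, ha, zero_div,
    toMap_sym_zero hu] at h5
  simp at h5

end SymmetricFamily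

/-! ### Normal form of quadratic maps with an automorphism -/

section NormalForm

variable {K : Type*} [Field K]

lemma cross_mul_eq_of_ratio_eq {a b c d : K} (h : ratio a b = ratio c d) : a * d = c * b := by
  by_cases hd : d = 0
  · subst hd
    rw [ratio_zero_right, ratio_eq_infty_iff] at h
    simp [h]
  · have hb : b ≠ 0 := fun hb => by
      rw [hb, ratio_zero_right, eq_comm, ratio_eq_infty_iff] at h
      exact hd h
    rw [ratio_of_ne_zero _ hd, ratio_of_ne_zero _ hb, OnePoint.coe_eq_coe] at h
    field_simp at h
    linear_combination h

variable [DecidableEq K]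

/-- If `φ` commutes with `x ↦ l x + b`, the numerator and denominator of `φ` are
equivariant up to a constant factor. -/
lemma exists_comp_eq_of_commutes_affine [Infinite K] {φ : RatFunc K} {l b : K} (hl : l ≠ 0)
    (h : ∀ P, gl l b 0 1 (by simpa) • toMap φ P = toMap φ (gl l b 0 1 (by simpa) • P)) :
    ∃ c : K, φ.denom.comp (C l * X + C b) = C c * φ.denom ∧
      φ.num.comp (C l * X + C b) = C c * (C l * φ.num + C b * φ.denom) := by
  set p := φ.num
  set q := φ.denom
  have hcop : IsCoprime q p := φ.isCoprime_num_denom.symm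
  have key : p.comp (C l * X + C b) * q = (C l * p + C b * q) * q.comp (C l * X + C b) := by
    refine funext fun x => ?_
    have hx := h (x : OnePoint K)
    rw [gl_smul_coe, zero_mul, zero_add, ratio_one_right, toMap_coe, toMap_coe,
      smul_ratio _ (eval_ne_zero φ x)] at hx
    have := cross_mul_eq_of_ratio_eq hx
    simp [gl, Matrix.GeneralLinearGroup.mkOfDetNeZero] at this
    simp only [eval_mul, eval_comp, eval_add, eval_C, eval_X]
    linear_combination -this
  have hlu : IsUnit (C l : K[X]) := isUnit_C.2 hl.isUnit
  have hq0 : q ≠ 0 := φ.denom_ne_zero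
  have hdvd : q ∣ q.comp (C l * X + C b) := by
    -- In p(lx + b)·q = (lp + bq)·q(lx + b), the factor q is coprime to lp + bq, so it divides q(lx
    -- + b), which has the same degree.
    have h1 : IsCoprime q (C l * p + C b * q) := by
      refine IsCoprime.add_mul_right_right ?_ _
      exact (isCoprime_mul_unit_left_right hlu _ _).2 hcop
    exact h1.dvd_of_dvd_mul_left ⟨_, by rw [← key, mul_comm]⟩
  obtain ⟨r, hr⟩ := hdvd
  have hdeg : (q.comp (C l * X + C b)).natDegree = q.natDegree := by
    rw [natDegree_comp, natDegree_linear hl, mul_one]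
  have hr0 : r ≠ 0 := by
    rintro rfl
    rw [mul_zero, comp_eq_zero_iff] at hr
    rcases hr with hr | ⟨-, hr⟩
    · exact hq0 hr
    · have := congrArg (coeff · 1) hr
      simp [coeff_C] at this
      exact hl this
  rw [hr, natDegree_mul hq0 hr0] at hdeg
  obtain ⟨c, rfl⟩ := natDegree_eq_zero.1 (show r.natDegree = 0 by omega)
  refine ⟨c, by rw [hr, mul_comm], mul_right_cancel₀ hq0 ?_⟩
  rw [key, hr]
  ring

omit [DecidableEq K] in
lemma eq_sum_of_natDegree_le_two {p : K[X]} (hp : p.natDegree ≤ 2) :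
    p = C (p.coeff 2) * X ^ 2 + C (p.coeff 1) * X + C (p.coeff 0) :=
  eq_quadratic_of_degree_le_two (natDegree_le_iff_degree_le.1 hp)

variable [CharZero K]

/-- The denominator q is invariant under x ↦ x + b, hence constant in characteristic zero. Then p(x
+ b) - p = bq is constant, so p has degree at most one, against degree two. -/
lemma not_commutes_translation {φ : RatFunc K} (hφ : deg φ = 2) {b : K} (hb : b ≠ 0)
    (h : ∀ P, gl 1 b 0 1 (by simp) • toMap φ P = toMap φ (gl 1 b 0 1 (by simp) • P)) : False := by
  obtain ⟨c, hq, hp⟩ := exists_comp_eq_of_commutes_affine one_ne_zero h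
  have hpd := (natDegree_num_le φ).trans_eq hφ
  have hqd := (natDegree_denom_le φ).trans_eq hφ
  have hcoef := coeff_deg_ne_zero φ
  rw [hφ] at hcoef
  have hc : c = 1 := by
    have := congrArg leadingCoeff hq
    rw [leadingCoeff_comp (by simp), leadingCoeff_mul, φ.monic_denom.leadingCoeff] at this
    simpa using this.symm
  subst hc
  have hqq := eq_sum_of_natDegree_le_two hqd
  have hpp := eq_sum_of_natDegree_le_two hpd
  generalize φ.num.coeff 0 = p0, φ.num.coeff 1 = p1, φ.num.coeff 2 = p2,
    φ.denom.coeff 0 = q0, φ.denom.coeff 1 = q1, φ.denom.coeff 2 = q2 at *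
  rw [hqq] at hq
  rw [hpp, hqq] at hp
  have e1 := congrArg (eval 0) hq
  have e2 := congrArg (eval 1) hq
  have e3 := congrArg (eval (-1)) hq
  have f1 := congrArg (eval 0) hp
  have f2 := congrArg (eval 1) hp
  have f3 := congrArg (eval (-1)) hp
  simp at e1 e2 e3 f1 f2 f3
  have hq2 : q2 = 0 := by
    have : q2 * b = 0 := by linear_combination (e2 - e3) / 4
    exact (mul_eq_zero.1 this).resolve_right hb
  subst hq2
  have hp2 : p2 = 0 := by
    have hq1 : q1 = 0 := by
      have : q1 * b = 0 := by linear_combination e1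
      exact (mul_eq_zero.1 this).resolve_right hb
    subst hq1
    have : p2 * b = 0 := by linear_combination (f2 - f3) / 4
    exact (mul_eq_zero.1 this).resolve_right hb
  simp [hp2] at hcoef

variable [IsAlgClosed K]

omit [IsAlgClosed K] [DecidableEq K] in
lemma toMap_sym_ratio {u : K} (hu : u ≠ 0) {x y : K} (hxy : x ≠ 0 ∨ y ≠ 0) :
    (u * (x ^ 2 + y ^ 2) ≠ 0 ∨ 2 * (x * y) ≠ 0) ∧
    toMap (sym u) (ratio x y) = ratio (u * (x ^ 2 + y ^ 2)) (2 * (x * y)) := by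
  constructor
  · by_contra! hc
    rcases mul_eq_zero.1 ((mul_eq_zero.1 hc.2).resolve_left two_ne_zero) with h | h <;> simp_all
  · rw [(toMap_ratio _ hxy).2, deg_sym hu, (sym_num_denom hu).1, (sym_num_denom hu).2,
      ← ratio_mul_right _ _ (two_ne_zero (α := K))]
    simp [homEval, Finset.sum_range_succ, coeff_X, coeff_one, coeff_X_pow]
    congr 1 <;> ring

omit [IsAlgClosed K] in
/-- A criterion for conjugacy to `sym u` in homogeneous coordinates. -/
lemma mapConj_sym_of_forall_ratio {φ : RatFunc K} {u : K} (hu : u ≠ 0) {F G : K → K → K}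
    (hφ : ∀ x y : K, x ≠ 0 ∨ y ≠ 0 → toMap φ (ratio x y) = ratio (F x y) (G x y))
    {a b c d r : K} (hdet : a * d - b * c ≠ 0) (hr : r ≠ 0)
    (hF : ∀ x y, (a * (u * (x ^ 2 + y ^ 2)) + b * (2 * (x * y))) * r =
      F (a * x + b * y) (c * x + d * y))
    (hG : ∀ x y, (c * (u * (x ^ 2 + y ^ 2)) + d * (2 * (x * y))) * r =
      G (a * x + b * y) (c * x + d * y)) :
    MapConj (toMap φ) (toMap (sym u)) := by
  refine ⟨gl a b c d hdet, fun P => ?_⟩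
  obtain ⟨x, y, hxy, rfl⟩ := exists_eq_ratio P
  have hg := smul_coords_ne_zero (gl a b c d hdet) hxy
  rw [(toMap_sym_ratio hu hxy).2, smul_ratio _ (toMap_sym_ratio hu hxy).1, smul_ratio _ hxy,
    hφ _ _ hg, ← ratio_mul_right _ _ hr]
  change ratio ((a * (u * (x ^ 2 + y ^ 2)) + b * (2 * (x * y))) * r)
    ((c * (u * (x ^ 2 + y ^ 2)) + d * (2 * (x * y))) * r) =
    ratio (F (a * x + b * y) (c * x + d * y)) (G (a * x + b * y) (c * x + d * y))
  rw [hF, hG]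

omit [IsAlgClosed K] [DecidableEq K] [CharZero K] in
lemma toMap_ratio_of_deg_two {φ : RatFunc K} (hφ : deg φ = 2) (x y : K) (hxy : x ≠ 0 ∨ y ≠ 0) :
    toMap φ (ratio x y) =
      ratio (φ.num.coeff 2 * x ^ 2 + φ.num.coeff 1 * (x * y) + φ.num.coeff 0 * y ^ 2)
        (φ.denom.coeff 2 * x ^ 2 + φ.denom.coeff 1 * (x * y) + φ.denom.coeff 0 * y ^ 2) := by
  rw [(toMap_ratio φ hxy).2, hφ]
  simp [homEval, Finset.sum_range_succ]
  congr 1 <;> ring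

/-- A quadratic map commuting with a nontrivial homothety is conjugate to some `sym u`. -/
lemma exists_mapConj_sym_of_commutes_homothety {φ : RatFunc K} (hφ : deg φ = 2) {l : K}
    (hl : l ≠ 0) (hl1 : l ≠ 1)
    (h : ∀ P, gl l 0 0 1 (by simpa) • toMap φ P = toMap φ (gl l 0 0 1 (by simpa) • P)) :
    ∃ u : K, u ≠ 0 ∧ MapConj (toMap φ) (toMap (sym u)) := by
  obtain ⟨c, hq, hp⟩ := exists_comp_eq_of_commutes_affine hl h
  have hmap := toMap_ratio_of_deg_two hφ
  have hcoef := coeff_deg_ne_zero φ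
  have hev := eval_ne_zero φ 0
  have hq0 := φ.denom_ne_zero
  have hqq := eq_sum_of_natDegree_le_two ((natDegree_denom_le φ).trans_eq hφ)
  rw [hφ] at hcoef
  rw [← coeff_zero_eq_eval_zero, ← coeff_zero_eq_eval_zero] at hev
  simp only [C_0, add_zero, zero_mul] at hp hq
  have eq : ∀ i, φ.denom.coeff i * l ^ i = c * φ.denom.coeff i := fun i => by
    have := congrArg (coeff · i) hq
    simpa using this
  have ep : ∀ i, φ.num.coeff i * l ^ i = c * (l * φ.num.coeff i) := fun i => by
    have := congrArg (coeff · i) hp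
    simpa using this
  have p0 := ep 0
  have p1 := ep 1
  have p2 := ep 2
  have q0 := eq 0
  have q1 := eq 1
  have q2 := eq 2
  have hpp := eq_sum_of_natDegree_le_two ((natDegree_num_le φ).trans_eq hφ)
  generalize φ.num.coeff 0 = a0, φ.num.coeff 1 = a1, φ.num.coeff 2 = a2,
    φ.denom.coeff 0 = b0, φ.denom.coeff 1 = b1, φ.denom.coeff 2 = b2 at *
  have hl1' : l - 1 ≠ 0 := sub_ne_zero.2 hl1
  -- Three shapes survive: a₁x/(b₂x² + b₀) with l² = 1, a₀/(b₂x²) with l³ = 1, and (a₂x² +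
  -- a₀)/(b₁x).
  by_cases ha2 : a2 = 0
  · have hb2 : b2 ≠ 0 := by simpa [ha2] using hcoef
    have hc : c = l ^ 2 := mul_left_cancel₀ hb2 (by linear_combination -q2)
    subst hc
    have hb1 : b1 = 0 := by
      have : b1 * (l * (l - 1)) = 0 := by linear_combination -q1
      exact (mul_eq_zero.1 this).resolve_right (mul_ne_zero hl hl1')
    by_cases ha0 : a0 = 0
    · have hb0 : b0 ≠ 0 := by simpa [ha0] using hev
      have hll : l ^ 2 = 1 := mul_left_cancel₀ hb0 (by linear_combination -q0)
      have ha1 : a1 ≠ 0 := by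
        rintro rfl
        obtain ⟨x, hx⟩ := IsAlgClosed.exists_pow_nat_eq (-b0 / b2) (n := 2) (by norm_num)
        have hden : φ.denom.eval x = 0 := by
          rw [hqq, hb1]
          simp [hx]
          field_simp
          ring
        have hnum : φ.num = 0 := by
          rw [hpp, ha2, ha0]
          simp
        have := eval_ne_zero φ x
        simp [hden, hnum] at this
      -- The critical points are ±s, and 0 is fixed with fibre {0, ∞}; so x ↦ s/x carries ±1 to ±s
      -- and ∞ to 0.
      obtain ⟨s, hs⟩ := IsAlgClosed.exists_pow_nat_eq (b0 / b2) (n := 2) (by norm_num)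
      have hs0 : s ≠ 0 := by
        rintro rfl
        rw [eq_comm, zero_pow two_ne_zero, div_eq_zero_iff] at hs
        tauto
      have hs' : b2 * s ^ 2 = b0 := by rw [hs]; field_simp
      have hu : 2 * b0 / a1 ≠ 0 := by simp [ha1, hb0]
      refine ⟨2 * b0 / a1, hu, mapConj_sym_of_forall_ratio hu hmap (a := 0) (b := s) (c := 1)
        (d := 0) (r := a1 / 2) (by simpa) (by simpa) (fun x y => ?_) fun x y => ?_⟩
      · rw [ha2, ha0]
        ring
      · rw [hb1]
        field_simp
        linear_combination -y ^ 2 * hs'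
    · have hl3 : l ^ 3 = 1 := mul_left_cancel₀ ha0 (by linear_combination -p0)
      have hl2 : l ^ 2 - 1 ≠ 0 := fun h2 => hl1 (by linear_combination hl3 - l * h2)
      have hb0 : b0 = 0 := by
        have : b0 * (l ^ 2 - 1) = 0 := by linear_combination -q0
        exact (mul_eq_zero.1 this).resolve_right hl2
      have ha1 : a1 = 0 := by
        have : a1 * (l * (l ^ 2 - 1)) = 0 := by linear_combination -p1
        exact (mul_eq_zero.1 this).resolve_right (mul_ne_zero hl hl2)
      -- Here s is a fixed point and the critical points are 0 and ∞; x ↦ s(x - 1)/(x + 1) carries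
      -- 1, -1, ∞ to 0, ∞, s. The critical points are swapped, whence u = -1.
      obtain ⟨s, hs⟩ := IsAlgClosed.exists_pow_nat_eq (a0 / b2) (n := 3) (by norm_num)
      have hs0 : s ≠ 0 := by
        rintro rfl
        rw [eq_comm, zero_pow three_ne_zero, div_eq_zero_iff] at hs
        tauto
      have hs' : b2 * s ^ 3 = a0 := by rw [hs]; field_simp
      refine ⟨-1, by simp, mapConj_sym_of_forall_ratio (by simp) hmap (a := s) (b := -s) (c := 1)
        (d := 1) (r := -b2 * s ^ 2) ?_ (by simp [hb2, hs0]) (fun x y => ?_) fun x y => ?_⟩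
      · ring_nf
        simpa
      · rw [ha2, ha1]
        linear_combination (x + y) ^ 2 * hs'
      · rw [hb1, hb0]
        ring
  · have hc : c = l := mul_left_cancel₀ (mul_ne_zero hl ha2) (by linear_combination -p2)
    subst hc
    have hb0 : b0 = 0 := by
      have : b0 * (c - 1) = 0 := by linear_combination -q0
      exact (mul_eq_zero.1 this).resolve_right hl1'
    have ha0 : a0 ≠ 0 := by simpa [hb0] using hev
    have ha1 : a1 = 0 := by
      have : a1 * (c * (c - 1)) = 0 := by linear_combination -p1
      exact (mul_eq_zero.1 this).resolve_right (mul_ne_zero hl hl1')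
    have hb2 : b2 = 0 := by
      have : b2 * (c * (c - 1)) = 0 := by linear_combination q2
      exact (mul_eq_zero.1 this).resolve_right (mul_ne_zero hl hl1')
    have hb1 : b1 ≠ 0 := by
      rintro rfl
      rw [hqq, hb2, hb0] at hq0
      simp at hq0
    -- The critical points are ±s and ∞ is already fixed, so rescaling by s suffices.
    obtain ⟨s, hs⟩ := IsAlgClosed.exists_pow_nat_eq (a0 / a2) (n := 2) (by norm_num)
    have hs0 : s ≠ 0 := by
      rintro rfl
      rw [eq_comm, zero_pow two_ne_zero, div_eq_zero_iff] at hs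
      tauto
    have hs' : a2 * s ^ 2 = a0 := by rw [hs]; field_simp
    have hu : 2 * a2 / b1 ≠ 0 := by simp [ha2, hb1]
    refine ⟨2 * a2 / b1, hu, mapConj_sym_of_forall_ratio hu hmap (a := s) (b := 0) (c := 0)
      (d := 1) (r := b1 * s / 2) (by simpa) (by simp [hb1, hs0]) (fun x y => ?_) fun x y => ?_⟩
    · rw [ha1]
      field_simp
      linear_combination y ^ 2 * hs'
    · rw [hb2, hb0]
      ring

/-- A quadratic map commuting with a nontrivial affine map is conjugate to some `sym u`. -/
lemma exists_mapConj_sym_of_commutes_affine {φ : RatFunc K} (hφ : deg φ = 2) {l b : K}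
    (hl : l ≠ 0) (hlb : l ≠ 1 ∨ b ≠ 0)
    (h : ∀ P, gl l b 0 1 (by simpa) • toMap φ P = toMap φ (gl l b 0 1 (by simpa) • P)) :
    ∃ u : K, u ≠ 0 ∧ MapConj (toMap φ) (toMap (sym u)) := by
  by_cases hl1 : l = 1
  · subst hl1
    exact (not_commutes_translation hφ (by simpa using hlb) h).elim
  · have hl1' : 1 - l ≠ 0 := sub_ne_zero.2 (Ne.symm hl1)
    -- The finite fixed point of x ↦ lx + b is b/(1 - l); it is moved to 0.
    obtain ⟨ψ, hψ, hconj⟩ := exists_conj (φ := φ) (by omega) (gl 1 (b / (1 - l)) 0 1 (by simp))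
    obtain ⟨u, hu, hu'⟩ := exists_mapConj_sym_of_commutes_homothety (hψ.trans hφ) hl hl1
      (fun P => by
        have hg : ∀ P : OnePoint K, gl 1 (b / (1 - l)) 0 1 (by simp) • gl l 0 0 1 (by simpa) • P =
            gl l b 0 1 (by simpa) • gl 1 (b / (1 - l)) 0 1 (by simp) • P := fun P => by
          cases P with
          | infty => simp [gl_smul_infty]
          | coe x =>
            simp only [gl_smul_coe, zero_mul, zero_add, ratio_one_right, OnePoint.coe_eq_coe]
            field_simp
            ring
        rw [← smul_left_cancel_iff (gl 1 (b / (1 - l)) 0 1 (by simp)), hg, hconj, hconj, hg, h])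
    exact ⟨u, hu, MapConj.trans ⟨_, hconj⟩ hu'⟩

omit [CharZero K] in
lemma exists_smul_eq_self (g : GL (Fin 2) K) : ∃ P : OnePoint K, g • P = P := by
  by_cases hc : g 1 0 = 0
  · exact ⟨_, OnePoint.smul_infty_eq_self_iff.2 hc⟩
  · have hdeg : (C (g 1 0) * X ^ 2 + C (g 1 1 - g 0 0) * X + C (-g 0 1) : K[X]).degree = 2 :=
      degree_quadratic hc
    obtain ⟨x, hx⟩ := IsAlgClosed.exists_root _ (by rw [hdeg]; norm_num :
      (C (g 1 0) * X ^ 2 + C (g 1 1 - g 0 0) * X + C (-g 0 1) : K[X]).degree ≠ 0)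
    refine ⟨x, smul_coe_eq_coe_iff.2 ?_⟩
    simp at hx
    linear_combination -hx

omit [CharZero K] [IsAlgClosed K] in
lemma exists_smul_infty_eq (P : OnePoint K) :
    ∃ g : GL (Fin 2) K, g • (OnePoint.infty : OnePoint K) = P := by
  cases P with
  | infty => exact ⟨1, one_smul _ _⟩
  | coe x => exact ⟨gl x 1 1 0 (by simp), by rw [gl_smul_infty, ratio_one_right]⟩

omit [CharZero K] [IsAlgClosed K] in
lemma exists_affine_of_smul_infty (g : GL (Fin 2) K)
    (hg : g • (OnePoint.infty : OnePoint K) = OnePoint.infty) :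
    ∃ (l b : K) (hl : l ≠ 0), ∀ P : OnePoint K, g • P = gl l b 0 1 (by simpa) • P := by
  rw [OnePoint.smul_infty_eq_self_iff] at hg
  have hdet := g.det_ne_zero
  rw [Matrix.det_fin_two, hg, mul_zero, sub_zero] at hdet
  have hd := right_ne_zero_of_mul hdet
  have ha := left_ne_zero_of_mul hdet
  refine ⟨g 0 0 / g 1 1, g 0 1 / g 1 1, div_ne_zero ha hd, fun P => ?_⟩
  cases P with
  | infty => rw [OnePoint.smul_infty_eq_self_iff.2 hg, gl_smul_infty, ratio_zero_right]
  | coe x =>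
    rw [gl_smul_coe, zero_mul, zero_add, ratio_one_right, smul_coe_eq_coe_iff, hg]
    field_simp
    simp

/-- Every quadratic map with a nontrivial automorphism is conjugate to some `sym u`. -/
theorem exists_mapConj_sym {φ σ : RatFunc K} (hφ : deg φ = 2) (hσ : σ ∈ Aut φ)
    (hσ1 : σ ≠ RatFunc.X) : ∃ u : K, u ≠ 0 ∧ MapConj (toMap φ) (toMap (sym u)) := by
  obtain ⟨g, rfl, hg⟩ := IsConjBy.exists_smul (by omega) hσ
  obtain ⟨P₀, hP₀⟩ := exists_smul_eq_self g
  obtain ⟨k, rfl⟩ := exists_smul_infty_eq P₀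
  obtain ⟨ψ, hψ, hconj⟩ := exists_conj (φ := φ) (by omega) k
  obtain ⟨l, b, hl, haff⟩ := exists_affine_of_smul_infty (k⁻¹ * g * k)
    (by rw [mul_smul, mul_smul, hP₀, inv_smul_smul])
  have hlb : l ≠ 1 ∨ b ≠ 0 := by
    by_contra! hc
    obtain ⟨rfl, rfl⟩ := hc
    refine hσ1 (toMap_injective ?_)
    funext P
    rw [toMap_mobius, toMap_X, id]
    have h1 := haff (k⁻¹ • P)
    have h2 : gl (1 : K) 0 0 1 (by simp) • (k⁻¹ • P) = k⁻¹ • P := by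
      cases k⁻¹ • P with
      | infty => simp [gl_smul_infty]
      | coe x => simp [gl_smul_coe]
    rwa [h2, mul_smul, mul_smul, smul_inv_smul, smul_left_cancel_iff] at h1
  obtain ⟨u, hu, hu'⟩ := exists_mapConj_sym_of_commutes_affine (hψ.trans hφ) hl hlb (fun P => by
    rw [← haff, ← haff, ← smul_left_cancel_iff k, hconj]
    simp only [mul_smul, smul_inv_smul]
    rw [hconj, hg])
  exact ⟨u, hu, MapConj.trans ⟨_, hconj⟩ hu'⟩

end NormalForm

/-! ### The critical orbit and its period equations -/

section Orbit

variable {K : Type*} [Field K] [CharZero K] {u : K}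

lemma iterate_sym_infty (hu : u ≠ 0) (n : ℕ) :
    (toMap (sym u))^[n] OnePoint.infty = OnePoint.infty :=
  Function.iterate_fixed (toMap_sym_infty hu) n

lemma toMap_sym_eq_coe_iff (hu : u ≠ 0) {x y : K} :
    toMap (sym u) (x : OnePoint K) = y ↔ x ≠ 0 ∧ u * (x ^ 2 + 1) = 2 * x * y := by
  by_cases hx : x = 0
  · subst hx
    simp [toMap_sym_zero hu]
  · rw [toMap_sym_of_ne_zero hu hx, OnePoint.coe_eq_coe, div_eq_iff hx]
    refine ⟨fun h => ⟨hx, by linear_combination 2 * h⟩, fun h => by linear_combination h.2 / 2⟩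

lemma iterate_two_sym_one (hu : u ≠ 0) :
    (toMap (sym u))^[2] ((1 : K) : OnePoint K) = (((u ^ 2 + 1) / 2 : K) : OnePoint K) := by
  rw [Function.iterate_succ_apply, Function.iterate_one, toMap_sym_one hu,
    toMap_sym_eq_coe_iff hu]
  exact ⟨hu, by ring⟩

lemma iterate_three_sym_one (hu : u ≠ 0) (h : u ^ 2 + 1 ≠ 0) :
    (toMap (sym u))^[3] ((1 : K) : OnePoint K) =
      ((u * ((u ^ 2 + 1) ^ 2 + 4) / (4 * (u ^ 2 + 1)) : K) : OnePoint K) := by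
  rw [Function.iterate_succ_apply', iterate_two_sym_one hu, toMap_sym_eq_coe_iff hu]
  refine ⟨by simpa using h, ?_⟩
  field_simp
  ring

/-- When u² = -1 the second iterate of 1 is 0, which maps to the fixed point ∞. This is the case
excluded from the formula for the third iterate. -/
lemma iterate_sym_one_of_sq (hu : u ≠ 0) (h : u ^ 2 + 1 = 0) (n : ℕ) :
    (toMap (sym u))^[n + 3] ((1 : K) : OnePoint K) = OnePoint.infty := by
  rw [Function.iterate_add_apply, Function.iterate_succ_apply', iterate_two_sym_one hu, h, zero_div,
    toMap_sym_zero hu, iterate_sym_infty hu]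

lemma isFixedPt_sym_one_iff (hu : u ≠ 0) :
    Function.IsFixedPt (toMap (sym u)) ((1 : K) : OnePoint K) ↔ u = 1 := by
  rw [Function.IsFixedPt, toMap_sym_one hu, OnePoint.coe_eq_coe]

lemma isPeriodicPt_two_sym_one_iff (hu : u ≠ 0) :
    Function.IsPeriodicPt (toMap (sym u)) 2 ((1 : K) : OnePoint K) ↔ u ^ 2 = 1 := by
  rw [Function.IsPeriodicPt, Function.IsFixedPt, iterate_two_sym_one hu, OnePoint.coe_eq_coe]
  exact ⟨fun h => by linear_combination 2 * h, fun h => by linear_combination h / 2⟩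

lemma isPeriodicPt_three_sym_one_iff (hu : u ≠ 0) :
    Function.IsPeriodicPt (toMap (sym u)) 3 ((1 : K) : OnePoint K) ↔
      (u - 1) * (u ^ 4 + u ^ 3 + 3 * u ^ 2 - u + 4) = 0 := by
  rw [Function.IsPeriodicPt, Function.IsFixedPt]
  by_cases h : u ^ 2 + 1 = 0
  · rw [iterate_sym_one_of_sq hu h 0]
    simp only [OnePoint.infty_ne_coe, false_iff]
    intro h'
    apply hu
    linear_combination (h' - (u ^ 3 + u - 4) * h) / 4
  · rw [iterate_three_sym_one hu h, OnePoint.coe_eq_coe, div_eq_one_iff_eq (by simpa)]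
    refine ⟨fun h => by linear_combination h, fun h => by linear_combination h⟩

lemma isPeriodicPt_four_sym_one_iff (hu : u ≠ 0) :
    Function.IsPeriodicPt (toMap (sym u)) 4 ((1 : K) : OnePoint K) ↔
      (u ^ 2 - 1) * ((u ^ 2 + 3) * (u ^ 6 + 2 * u ^ 4 + 5 * u ^ 2 + 8)) = 0 := by
  rw [Function.IsPeriodicPt, Function.IsFixedPt]
  by_cases h : u ^ 2 + 1 = 0
  · rw [iterate_sym_one_of_sq hu h 1]
    simp only [OnePoint.infty_ne_coe, false_iff]
    obtain h : u ^ 2 = -1 := by linear_combination h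
    have h4 : u ^ 4 = 1 := by linear_combination (u ^ 2 - 1) * h
    have h6 : u ^ 6 = -1 := by linear_combination (u ^ 4 - u ^ 2 + 1) * h
    rw [h, h4, h6]
    norm_num
  · rw [Function.iterate_succ_apply', iterate_three_sym_one hu h, toMap_sym_eq_coe_iff hu]
    set A := (u ^ 2 + 1) ^ 2 + 4 with hA
    have key : u * ((u * A / (4 * (u ^ 2 + 1))) ^ 2 + 1) = 2 * (u * A / (4 * (u ^ 2 + 1))) * 1 ↔
        u ^ 2 * A ^ 2 + 16 * (u ^ 2 + 1) ^ 2 = 8 * A * (u ^ 2 + 1) := by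
      field_simp
      constructor <;> intro h <;> linear_combination h
    rw [key]
    constructor
    · rintro ⟨-, h⟩
      linear_combination h
    · intro h'
      have h'' : u ^ 2 * A ^ 2 + 16 * (u ^ 2 + 1) ^ 2 = 8 * A * (u ^ 2 + 1) := by
        linear_combination h'
      refine ⟨?_, h''⟩
      -- The third iterate must be nonzero; if A = 0, the equation would reduce to 16(u² + 1)² = 0.
      have hA0 : A ≠ 0 := by
        intro hA0
        rw [hA0] at h''
        simp [h] at h''
      simp [hu, hA0, h]

lemma minimalPeriod_sym_one_eq_two_iff (hu : u ≠ 0) :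
    Function.minimalPeriod (toMap (sym u)) ((1 : K) : OnePoint K) = 2 ↔ u = -1 := by
  constructor
  · intro h
    have h2 := (isPeriodicPt_two_sym_one_iff hu).1 (h ▸ Function.isPeriodicPt_minimalPeriod _ _)
    refine (mul_self_eq_one_iff.1 (by rw [← sq, h2])).resolve_left fun h1 => ?_
    have := Function.minimalPeriod_eq_one_iff_isFixedPt.2 ((isFixedPt_sym_one_iff hu).2 h1)
    omega
  · rintro rfl
    refine Function.minimalPeriod_eq_prime ?_ ?_
    · rw [isPeriodicPt_two_sym_one_iff hu]; norm_num
    · rw [isFixedPt_sym_one_iff hu]; norm_num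

lemma minimalPeriod_sym_one_eq_three_iff (hu : u ≠ 0) :
    Function.minimalPeriod (toMap (sym u)) ((1 : K) : OnePoint K) = 3 ↔
      u ^ 4 + u ^ 3 + 3 * u ^ 2 - u + 4 = 0 := by
  constructor
  · intro h
    have h3 := (isPeriodicPt_three_sym_one_iff hu).1 (h ▸ Function.isPeriodicPt_minimalPeriod _ _)
    refine (mul_eq_zero.1 h3).resolve_left fun h1 => ?_
    have := Function.minimalPeriod_eq_one_iff_isFixedPt.2
      ((isFixedPt_sym_one_iff hu).2 (sub_eq_zero.1 h1))
    omega
  · intro h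
    refine Function.minimalPeriod_eq_prime ?_ ?_
    · rw [isPeriodicPt_three_sym_one_iff hu, h, mul_zero]
    · rw [isFixedPt_sym_one_iff hu]
      rintro rfl
      norm_num at h

lemma minimalPeriod_sym_one_eq_four_iff (hu : u ≠ 0) :
    Function.minimalPeriod (toMap (sym u)) ((1 : K) : OnePoint K) = 4 ↔
      (u ^ 2 + 3) * (u ^ 6 + 2 * u ^ 4 + 5 * u ^ 2 + 8) = 0 := by
  constructor
  · intro h
    have h4 := (isPeriodicPt_four_sym_one_iff hu).1 (h ▸ Function.isPeriodicPt_minimalPeriod _ _)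
    refine (mul_eq_zero.1 h4).resolve_left fun h1 => ?_
    have := ((isPeriodicPt_two_sym_one_iff hu).2 (sub_eq_zero.1 h1)).minimalPeriod_dvd
    rw [h] at this
    norm_num at this
  · intro h
    -- For least period 4 = 2² it is enough that 4 is a period and 2 is not.
    refine Function.minimalPeriod_eq_prime_pow (p := 2) (k := 1) ?_ ?_
    · rw [pow_one, isPeriodicPt_two_sym_one_iff hu]
      intro h2
      have h4 : u ^ 4 = 1 := by linear_combination (u ^ 2 + 1) * h2
      have h6 : u ^ 6 = 1 := by linear_combination (u ^ 4 + u ^ 2 + 1) * h2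
      rw [h2, h4, h6] at h
      norm_num at h
    · norm_num1
      rw [isPeriodicPt_four_sym_one_iff hu, h, mul_zero]

end Orbit

/-! ### Classes of the symmetry locus with a periodic critical point -/

section Classes

variable {K : Type*} [Field K] [CharZero K] [IsAlgClosed K]

lemma mem_symmetryLocus_sym {u : K} (hu : u ≠ 0) : conjClass (sym u) ∈ symmetryLocus K := by
  classical
  refine ⟨sym u, deg_sym hu, rfl, mobius (negGL K),
    isConjBy_mobius (by rw [deg_sym hu]; norm_num) (negGL_smul_toMap_sym hu), fun h => ?_⟩
  have := congrFun (congrArg toMap h) ((1 : K) : OnePoint K)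
  rw [toMap_mobius, negGL_smul_coe, toMap_X, id, OnePoint.coe_eq_coe] at this
  norm_num at this

/-- A conjugacy to `sym u` sends the periodic critical point to 1 or -1, and these have the same
period, so only the orbit of 1 matters. -/
lemma mem_perCurve_inter_symmetryLocus_iff {n : ℕ} (hn : 0 < n) {c : Set (RatFunc K)} :
    c ∈ perCurve K n ∩ symmetryLocus K ↔ ∃ u : K, u ≠ 0 ∧ c = conjClass (sym u) ∧
      Function.minimalPeriod (toMap (sym u)) ((1 : K) : OnePoint K) = n := by
  classical
  constructor
  · rintro ⟨⟨φ, hφ, rfl, P, hP, -, hper⟩, ψ, hψ, hφψ, σ, hσ, hσ1⟩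
    have hφ : deg φ = 2 := hφ
    have hψ : deg ψ = 2 := hψ
    obtain ⟨u, hu, hconj⟩ := exists_mapConj_sym hψ hσ hσ1
    have hd := deg_sym hu
    have hφu : MapConj (toMap (sym u)) (toMap φ) :=
      (((conjClass_eq_iff (by omega) (by omega)).1 hφψ).trans hconj).symm
    refine ⟨u, hu, (conjClass_eq_iff (by omega) (by omega)).2 hφu.symm, ?_⟩
    obtain ⟨γ, hγ⟩ := hφu
    rw [← minimalPeriod_smul hγ] at hper
    rcases eq_one_or_neg_one_of_fiber hu (P := γ • P) (fun Q hQ => by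
      rw [← inv_smul_eq_iff]
      refine hP.eq_of_toMap_eq hφ ?_
      rw [← smul_left_cancel_iff γ, hγ, hγ, smul_inv_smul, hQ]) with h | h
    · rwa [h] at hper
    · rwa [h, minimalPeriod_sym_neg_one hu] at hper
  · rintro ⟨u, hu, rfl, h⟩
    exact ⟨⟨sym u, deg_sym hu, rfl, _, isCriticalPoint_sym_one hu, hn, h⟩, mem_symmetryLocus_sym hu⟩

lemma conjClass_sym_injOn : Set.InjOn (fun u : K => conjClass (sym u)) {0}ᶜ := by
  classical
  intro u hu v hv h
  simp only [Set.mem_compl_iff, Set.mem_singleton_iff] at hu hv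
  have h1 := deg_sym hu
  have h2 := deg_sym hv
  exact eq_of_mapConj_sym hu hv ((conjClass_eq_iff (by omega) (by omega)).1 h)

lemma conjClass_inv_sq : conjClass (1 / RatFunc.X ^ 2 : RatFunc K) = conjClass (sym (-1)) := by
  classical
  have hnd := num_denom_of_isCoprime (p := (1 : K[X])) (monic_X_pow 2) isCoprime_one_left
  have hX : (1 / RatFunc.X ^ 2 : RatFunc K) =
      algebraMap K[X] _ 1 / algebraMap K[X] _ (X ^ 2) := by simp
  rw [← hX] at hnd
  have hd : deg (1 / RatFunc.X ^ 2 : RatFunc K) = 2 := by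
    rw [deg, hnd.1, hnd.2]
    simp
  have h1 := deg_sym (u := (-1 : K)) (by simp)
  refine (conjClass_eq_iff (by omega) (by omega)).2 ?_
  -- The map x ↦ (x - 1)/(x + 1) carries 1 and -1 to the critical points 0 and ∞ of 1/x².
  refine mapConj_sym_of_forall_ratio (by simp) (toMap_ratio_of_deg_two hd) (a := 1) (b := -1)
    (c := 1) (d := 1) (r := -1) (by norm_num) (by simp) (fun x y => ?_) fun x y => ?_
  · rw [hnd.1]
    simp [coeff_one]
    ring
  · rw [hnd.2]
    simp [coeff_X_pow]
    ring

end Classes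

/-! ### Galois action and field of moduli -/

section GaloisAction

variable {k L : Type*} [Field k] [Field L] [Algebra k L]

lemma map_ratio (τ : L ≃ₐ[k] L) (a b : L) : (ratio a b).map τ = ratio (τ a) (τ b) := by
  by_cases hb : b = 0
  · simp [hb]
  · rw [ratio_of_ne_zero _ hb, ratio_of_ne_zero _ (by simpa), OnePoint.map_some, map_div₀]

lemma galConj_num_denom (τ : L ≃ₐ[k] L) (φ : RatFunc L) :
    (galConj τ φ).num = φ.num.map (τ : L →+* L) ∧
    (galConj τ φ).denom = φ.denom.map (τ : L →+* L) := by
  have h1 : (φ.denom.map (τ : L →+* L)).Monic := φ.monic_denom.map _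
  have h2 : IsCoprime (φ.num.map (τ : L →+* L)) (φ.denom.map (τ : L →+* L)) :=
    φ.isCoprime_num_denom.map (mapRingHom (τ : L →+* L))
  exact num_denom_of_isCoprime h1 h2

lemma deg_galConj (τ : L ≃ₐ[k] L) (φ : RatFunc L) : deg (galConj τ φ) = deg φ := by
  rw [deg, (galConj_num_denom τ φ).1, (galConj_num_denom τ φ).2, natDegree_map, natDegree_map, deg]

lemma toMap_galConj (τ : L ≃ₐ[k] L) (φ : RatFunc L) (P : OnePoint L) :
    toMap (galConj τ φ) (P.map τ) = (toMap φ P).map τ := by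
  cases P with
  | infty =>
    rw [OnePoint.map_infty, toMap_infty, toMap_infty, (galConj_num_denom τ φ).1,
      (galConj_num_denom τ φ).2, deg_galConj, map_ratio, coeff_map, coeff_map]
    rfl
  | coe x =>
    rw [OnePoint.map_some, toMap_coe, toMap_coe, (galConj_num_denom τ φ).1,
      (galConj_num_denom τ φ).2, map_ratio]
    have := fun p : L[X] => eval_map_apply (p := p) (τ : L →+* L) x
    simp only [RingHom.coe_coe] at this
    rw [this, this]

lemma MapConj.galConj [DecidableEq L] {φ ψ : RatFunc L} (τ : L ≃ₐ[k] L)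
    (h : MapConj (toMap φ) (toMap ψ)) :
    MapConj (toMap (galConj τ φ)) (toMap (galConj τ ψ)) := by
  obtain ⟨γ, h⟩ := h
  have hmap : ∀ P : OnePoint L, (γ • P).map τ = γ.map (τ : L →+* L) • P.map τ :=
    OnePoint.map_smul (τ : L →+* L) γ
  refine ⟨γ.map (τ : L →+* L), fun P => ?_⟩
  obtain ⟨P, rfl⟩ : ∃ P', OnePoint.map τ P' = P := by
    cases P with
    | infty => exact ⟨OnePoint.infty, rfl⟩
    | coe x => exact ⟨(τ.symm x : L), by simp⟩
  rw [toMap_galConj, ← hmap, ← hmap, toMap_galConj, h]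

lemma galConj_sym [CharZero L] (τ : L ≃ₐ[k] L) {u : L} (hu : u ≠ 0) :
    galConj τ (sym u) = sym (τ u) := by
  rw [galConj, (sym_num_denom hu).1, (sym_num_denom hu).2, sym]
  have h2 : τ 2 = 2 := map_ofNat τ 2
  simp [h2]

/-- Applying τ to a conjugacy between φ and `sym u` gives one between φ^τ and `sym (τ u)`; the
invariance of the parameter then decides. -/
lemma galConj_mem_conjClass_iff [CharZero L] [DecidableEq L] {φ : RatFunc L} (hφ : 0 < deg φ)
    {u : L} (hu : u ≠ 0) (h : MapConj (toMap φ) (toMap (sym u))) (τ : L ≃ₐ[k] L) :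
    galConj τ φ ∈ conjClass φ ↔ τ u = u := by
  rw [mem_conjClass_iff hφ]
  have hτ := h.galConj τ
  rw [galConj_sym τ hu] at hτ
  constructor
  · intro h'
    exact (eq_of_mapConj_sym hu (by simpa) (h.symm.trans (h'.trans hτ))).symm
  · intro h'
    rw [h'] at hτ
    exact h.trans hτ.symm

/-- The field of moduli of the class of `sym u` is generated by `u`. -/
lemma fieldOfModuli_eq_adjoin [CharZero L] [DecidableEq L] [IsGalois k L] {φ : RatFunc L}
    (hφ : 0 < deg φ) {u : L} (hu : u ≠ 0) (h : MapConj (toMap φ) (toMap (sym u))) :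
    fieldOfModuli k φ = IntermediateField.adjoin k {u} := by
  -- By the Galois correspondence k(u) is the fixed field of the automorphisms fixing u, which are
  -- exactly those preserving the class.
  rw [← InfiniteGalois.fixedField_fixingSubgroup (IntermediateField.adjoin k {u})]
  ext x
  have hfix : ∀ τ : L ≃ₐ[k] L, τ ∈ (IntermediateField.adjoin k {u}).fixingSubgroup ↔ τ u = u := by
    intro τ
    rw [IntermediateField.mem_fixingSubgroup_iff]
    simpa using IntermediateField.forall_mem_adjoin_smul_eq_self_iff k (S := {u}) τ
  rw [IntermediateField.mem_fixedField_iff]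
  simp only [hfix]
  change (∀ τ : L ≃ₐ[k] L, galConj τ φ ∈ conjClass φ → τ x = x) ↔ _
  simp only [galConj_mem_conjClass_iff hφ hu h]

end GaloisAction

/-! ### Irreducibility and separability of the period polynomials -/

section Polynomials

lemma irreducible_map_rat_of_mod {p : ℤ[X]} (hp : p.Monic) (n : ℕ) [Fact n.Prime]
    (h : Irreducible (p.map (Int.castRingHom (ZMod n)))) :
    Irreducible (p.map (Int.castRingHom ℚ)) :=
  (hp.irreducible_iff_irreducible_map_fraction_map (K := ℚ)).1
    (Monic.irreducible_of_irreducible_map _ p hp h)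

/-- The polynomial of the parameters `u` for which `1` has period `3` under `sym u`. -/
def quartic : ℚ[X] := X ^ 4 + X ^ 3 + 3 * X ^ 2 - X + 4

/-- The minimal polynomial of `u ^ 2` for the roots `u` of `sextic`. -/
def cubic : ℚ[X] := X ^ 3 + 2 * X ^ 2 + 5 * X + 8

/-- A factor of the polynomial of the `u` for which `1` has period `4` under `sym u`. -/
def sextic : ℚ[X] := X ^ 6 + 2 * X ^ 4 + 5 * X ^ 2 + 8

lemma natDegree_quartic : quartic.natDegree = 4 := by
  unfold quartic
  compute_degree!

lemma monic_quartic : quartic.Monic := by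
  unfold quartic
  monicity!

lemma natDegree_cubic : cubic.natDegree = 3 := by
  unfold cubic
  compute_degree!

lemma monic_cubic : cubic.Monic := by
  unfold cubic
  monicity!

lemma natDegree_sextic : sextic.natDegree = 6 := by
  unfold sextic
  compute_degree!

lemma monic_sextic : sextic.Monic := by
  unfold sextic
  monicity!

lemma irreducible_quartic : Irreducible quartic := by
  have hm : (X ^ 4 + X ^ 3 + 3 * X ^ 2 - X + 4 : ℤ[X]).Monic := by monicity!
  have h := irreducible_map_rat_of_mod hm 3 ?_
  · simpa [quartic] using h
  set q : (ZMod 3)[X] := (X ^ 4 + X ^ 3 + 3 * X ^ 2 - X + 4 : ℤ[X]).map (Int.castRingHom _) with hq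
  have hqm : q.Monic := hm.map _
  have hq' : q = X ^ 4 + X ^ 3 + 3 * X ^ 2 - X + 4 := by simp [hq]
  have hdeg : q.natDegree = 4 := by
    rw [hq']
    compute_degree!
  -- Modulo 3 there is no root, and a finite check on coefficients excludes a product of two monic
  -- quadratics.
  have hroot : ∀ x : ZMod 3, q.eval x ≠ 0 := by
    simp only [hq', eval_add, eval_sub, eval_mul, eval_pow, eval_X, eval_ofNat]
    decide
  rw [hqm.irreducible_iff_lt_natDegree_lt (by intro h1; simp [h1] at hdeg)]
  intro r hr hrdeg hdvd
  rw [hdeg, Finset.mem_Ioc] at hrdeg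
  obtain ⟨s, hs⟩ := hdvd
  have hsm : s.Monic := hr.of_mul_monic_left (hs ▸ hqm)
  have hadd : r.natDegree + s.natDegree = 4 := by rw [← hr.natDegree_mul hsm, ← hs, hdeg]
  obtain h1 | h2 : r.natDegree = 1 ∨ r.natDegree = 2 := by omega
  · refine hroot (-r.coeff 0) ?_
    have := hr.coeff_natDegree
    rw [hs, eval_mul, hr.as_sum, h1]
    simp
  · have hs2 : s.natDegree = 2 := by omega
    have hrc := hr.coeff_natDegree
    have hsc := hsm.coeff_natDegree
    have hr' := eq_sum_of_natDegree_le_two h2.le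
    have hs' := eq_sum_of_natDegree_le_two hs2.le
    rw [h2] at hrc
    rw [hs2] at hsc
    rw [hrc] at hr'
    rw [hsc] at hs'
    generalize r.coeff 1 = a, r.coeff 0 = b, s.coeff 1 = c, s.coeff 0 = d at *
    have hprod : q = X ^ 4 + C (a + c) * X ^ 3 + C (b + d + a * c) * X ^ 2 +
        C (a * d + b * c) * X + C (b * d) := by
      rw [hs, hr', hs']
      simp only [C_add, C_mul, C_1]
      ring
    have hq'' : q = X ^ 4 + C 1 * X ^ 3 + C 3 * X ^ 2 + C (-1) * X + C 4 := by
      rw [hq']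
      simp only [C_neg, C_1, C_ofNat]
      ring
    have hcoeff := fun i => congrArg (coeff · i) (hprod.symm.trans hq'')
    have e0 := hcoeff 0
    have e1 := hcoeff 1
    have e2 := hcoeff 2
    have e3 := hcoeff 3
    simp only [coeff_add, coeff_C_mul, coeff_X_pow, coeff_X, coeff_C] at e0 e1 e2 e3
    norm_num at e0 e1 e2 e3
    clear * - e0 e1 e2 e3
    revert a b c d
    decide

lemma irreducible_cubic : Irreducible cubic := by
  have hm : (X ^ 3 + 2 * X ^ 2 + 5 * X + 8 : ℤ[X]).Monic := by monicity!
  have h := irreducible_map_rat_of_mod hm 3 ?_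
  · simpa [cubic] using h
  set q : (ZMod 3)[X] := (X ^ 3 + 2 * X ^ 2 + 5 * X + 8 : ℤ[X]).map (Int.castRingHom _) with hq
  have hqm : q.Monic := hm.map _
  have hq' : q = X ^ 3 + 2 * X ^ 2 + 5 * X + 8 := by simp [hq]
  have hdeg : q.natDegree = 3 := by
    rw [hq']
    compute_degree!
  rw [hqm.irreducible_iff_roots_eq_zero_of_degree_le_three (by omega) (by omega),
    Multiset.eq_zero_iff_forall_notMem]
  intro x hx
  have := isRoot_of_mem_roots hx
  rw [IsRoot, hq'] at this
  simp only [eval_add, eval_mul, eval_pow, eval_X, eval_ofNat] at this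
  clear hx
  revert x
  decide

variable {L : Type*} [Field L] [Algebra ℚ L]

lemma finrank_adjoin_of_irreducible {p : ℚ[X]} (hp : p.Monic) (hirr : Irreducible p) {u : L}
    (hu : aeval u p = 0) :
    Module.finrank ℚ (IntermediateField.adjoin ℚ {u}) = p.natDegree := by
  rw [IntermediateField.adjoin.finrank ⟨p, hp, hu⟩, ← minpoly.eq_of_irreducible_of_monic hirr hu hp]

lemma aeval_cubic_sq {u : L} (hu : aeval u sextic = 0) : aeval (u ^ 2) cubic = 0 := by
  rw [← hu]
  simp [cubic, sextic, aeval_def, eval₂_ofNat]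
  ring

/-- As ℚ(u²) ⊆ ℚ(u) is cubic, the degree of u is 3 or 6. Degree 3 would make the norm -8 of u² the
square of the norm of u. -/
lemma minpoly_eq_sextic {u : L} (hu : aeval u sextic = 0) : minpoly ℚ u = sextic := by
  have hint : IsIntegral ℚ u := ⟨sextic, monic_sextic, hu⟩
  have hmon := minpoly.monic hint
  have hdvd : minpoly ℚ u ∣ sextic := minpoly.dvd ℚ u hu
  have hw := aeval_cubic_sq hu
  have hcub := minpoly.eq_of_irreducible_of_monic irreducible_cubic hw monic_cubic
  have hle : (minpoly ℚ u).natDegree ≤ 6 :=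
    (natDegree_le_of_dvd hdvd monic_sextic.ne_zero).trans_eq natDegree_sextic
  have hpos := minpoly.natDegree_pos hint
  have hthree : 3 ∣ (minpoly ℚ u).natDegree := by
    have := IntermediateField.finrank_dvd_of_le_right (show
      IntermediateField.adjoin ℚ {u ^ 2} ≤ IntermediateField.adjoin ℚ {u} by
        rw [IntermediateField.adjoin_simple_le_iff]
        exact pow_mem (IntermediateField.mem_adjoin_simple_self ℚ u) 2)
    rwa [finrank_adjoin_of_irreducible monic_cubic irreducible_cubic hw, natDegree_cubic,
      IntermediateField.adjoin.finrank hint] at this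
  have hne : (minpoly ℚ u).natDegree ≠ 3 := by
    intro h3
    have hu3 := minpoly.aeval ℚ u
    rw [hmon.as_sum, h3] at hu3
    simp [Finset.sum_range_succ] at hu3
    generalize (minpoly ℚ u).coeff 0 = c, (minpoly ℚ u).coeff 1 = b,
      (minpoly ℚ u).coeff 2 = a at hu3
    -- With m = X³ + aX² + bX + c the minimal polynomial, t(X²) = -m(X)m(-X). So t vanishes at u²
    -- and equals `cubic`, and the constant terms give -c² = 8.
    set t : ℚ[X] := X ^ 3 + C (2 * b - a ^ 2) * X ^ 2 + C (b ^ 2 - 2 * a * c) * X + C (-c ^ 2)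
      with ht
    have htu : aeval (u ^ 2) t = 0 := by
      simp [ht]
      linear_combination (u ^ 3 - (a : L) * u ^ 2 + (b : L) * u - (c : L)) * hu3
    have htm : t.Monic := by
      rw [ht]
      monicity!
    have htd : t.natDegree ≤ cubic.natDegree := by
      rw [ht, natDegree_cubic]
      compute_degree
    have hct : cubic ∣ t := hcub ▸ minpoly.dvd ℚ (u ^ 2) htu
    have heq := eq_of_monic_of_dvd_of_natDegree_le monic_cubic htm hct htd
    have h0 := congrArg (eval 0) heq
    simp [ht, cubic] at h0
    nlinarith [sq_nonneg c]
  refine eq_of_monic_of_dvd_of_natDegree_le hmon monic_sextic hdvd ?_ |>.symm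
  rw [natDegree_sextic]
  omega

lemma irreducible_sextic : Irreducible sextic := by
  obtain ⟨u, hu⟩ := IsAlgClosed.exists_aeval_eq_zero (AlgebraicClosure ℚ) sextic
    (by rw [degree_eq_natDegree monic_sextic.ne_zero, natDegree_sextic]; norm_num)
  rw [← minpoly_eq_sextic hu]
  exact minpoly.irreducible ⟨sextic, monic_sextic, hu⟩

/-- A factor of the polynomial of the `u` for which `1` has period `4` under `sym u`. -/
def quadraticFactor : ℚ[X] := X ^ 2 + 3

lemma natDegree_quadraticFactor : quadraticFactor.natDegree = 2 := by
  unfold quadraticFactor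
  compute_degree!

lemma monic_quadraticFactor : quadraticFactor.Monic := by
  unfold quadraticFactor
  monicity!

lemma irreducible_quadraticFactor : Irreducible quadraticFactor := by
  rw [monic_quadraticFactor.irreducible_iff_roots_eq_zero_of_degree_le_three
    natDegree_quadraticFactor.ge (by rw [natDegree_quadraticFactor]; norm_num),
    Multiset.eq_zero_iff_forall_notMem]
  intro x hx
  have := isRoot_of_mem_roots hx
  simp [IsRoot, quadraticFactor] at this
  nlinarith [sq_nonneg x]

lemma separable_quadratic_mul_sextic : (quadraticFactor * sextic).Separable := by
  refine irreducible_quadraticFactor.separable.mul irreducible_sextic.separable ?_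
  refine (irreducible_quadraticFactor.coprime_iff_not_dvd).2 fun h => ?_
  have := irreducible_quadraticFactor.associated_of_dvd irreducible_sextic h
  have := natDegree_eq_of_degree_eq (degree_eq_degree_of_associated this)
  rw [natDegree_quadraticFactor, natDegree_sextic] at this
  norm_num at this

lemma ncard_rootSet [IsAlgClosed L] {p : ℚ[X]} (hp : p.Separable) :
    (p.rootSet L).ncard = p.natDegree := by
  rw [← card_rootSet_eq_natDegree hp (IsAlgClosed.splits (p.map (algebraMap ℚ L))),
    ← Nat.card_coe_set_eq, Nat.card_eq_fintype_card]

end Polynomials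

/-! ### Counting classes and computing their fields of moduli -/

section Main

variable {L : Type*} [Field L] [Algebra ℚ L] [IsAlgClosed L]

/-- The nonzero constant term keeps u = 0, where `sym u` degenerates, out of the root set. -/
lemma perCurve_inter_symmetryLocus_eq_image [CharZero L] {n : ℕ} (hn : 0 < n) {p : ℚ[X]}
    (hp0 : p.eval 0 ≠ 0)
    (hp : ∀ u : L, u ≠ 0 → (Function.minimalPeriod (toMap (sym u)) ((1 : L) : OnePoint L) = n ↔
      aeval u p = 0)) :
    perCurve L n ∩ symmetryLocus L = (fun u => conjClass (sym u)) '' p.rootSet L ∧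
    p.rootSet L ⊆ {0}ᶜ := by
  have hpne : p ≠ 0 := by
    rintro rfl
    simp at hp0
  have hsub : p.rootSet L ⊆ {0}ᶜ := by
    rintro _ hu rfl
    rw [mem_rootSet] at hu
    apply hp0
    have := hu.2
    rw [← map_zero (algebraMap ℚ L), aeval_algebraMap_apply, coe_aeval_eq_eval] at this
    exact (algebraMap ℚ L).injective this
  refine ⟨?_, hsub⟩
  ext c
  rw [mem_perCurve_inter_symmetryLocus_iff hn]
  constructor
  · rintro ⟨u, hu, rfl, h⟩
    exact ⟨u, mem_rootSet.2 ⟨hpne, (hp u hu).1 h⟩, rfl⟩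
  · rintro ⟨u, hu, rfl⟩
    exact ⟨u, hsub hu, rfl, (hp u (hsub hu)).2 (mem_rootSet.1 hu).2⟩

lemma ncard_perCurve_inter_symmetryLocus [CharZero L] {n : ℕ} (hn : 0 < n) {p : ℚ[X]}
    (hp0 : p.eval 0 ≠ 0) (hsep : p.Separable)
    (hp : ∀ u : L, u ≠ 0 → (Function.minimalPeriod (toMap (sym u)) ((1 : L) : OnePoint L) = n ↔
      aeval u p = 0)) :
    (perCurve L n ∩ symmetryLocus L).ncard = p.natDegree := by
  obtain ⟨h1, h2⟩ := perCurve_inter_symmetryLocus_eq_image hn hp0 hp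
  rw [h1, (conjClass_sym_injOn.mono h2).ncard_image, ncard_rootSet hsep]

lemma exists_fieldOfModuli_eq_adjoin [CharZero L] [IsGalois ℚ L] {n : ℕ} (hn : 0 < n)
    {p : ℚ[X]}
    (hp : ∀ u : L, u ≠ 0 → (Function.minimalPeriod (toMap (sym u)) ((1 : L) : OnePoint L) = n ↔
      aeval u p = 0)) {φ : RatFunc L} (hφ : deg φ = 2)
    (h : conjClass φ ∈ perCurve L n ∩ symmetryLocus L) :
    ∃ u : L, aeval u p = 0 ∧ fieldOfModuli ℚ φ = IntermediateField.adjoin ℚ {u} := by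
  classical
  obtain ⟨u, hu, heq, hper⟩ := (mem_perCurve_inter_symmetryLocus_iff hn).1 h
  have hd := deg_sym hu
  exact ⟨u, (hp u hu).1 hper, fieldOfModuli_eq_adjoin (by omega) hu
    ((conjClass_eq_iff (by omega) (by omega)).1 heq)⟩

end Main

end QuadDyn

end

theorem proposition2p3 :
    (QuadDyn.perCurve (AlgebraicClosure ℚ) 2 ∩ QuadDyn.symmetryLocus (AlgebraicClosure ℚ) =
      {QuadDyn.conjClass (1 / RatFunc.X ^ 2 : RatFunc (AlgebraicClosure ℚ))}) ∧
    ((QuadDyn.perCurve (AlgebraicClosure ℚ) 3 ∩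
        QuadDyn.symmetryLocus (AlgebraicClosure ℚ)).ncard = 4 ∧
      ∀ φ ∈ QuadDyn.Rat (AlgebraicClosure ℚ) 2,
        QuadDyn.conjClass φ ∈ QuadDyn.perCurve (AlgebraicClosure ℚ) 3 ∩
          QuadDyn.symmetryLocus (AlgebraicClosure ℚ) →
        Module.finrank ℚ (QuadDyn.fieldOfModuli ℚ φ) = 4) ∧
    ((QuadDyn.perCurve (AlgebraicClosure ℚ) 4 ∩
        QuadDyn.symmetryLocus (AlgebraicClosure ℚ)).ncard = 8 ∧
      ∀ φ ∈ QuadDyn.Rat (AlgebraicClosure ℚ) 2,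
        QuadDyn.conjClass φ ∈ QuadDyn.perCurve (AlgebraicClosure ℚ) 4 ∩
          QuadDyn.symmetryLocus (AlgebraicClosure ℚ) →
        (Module.finrank ℚ (QuadDyn.fieldOfModuli ℚ φ) = 2 ∨
          Module.finrank ℚ (QuadDyn.fieldOfModuli ℚ φ) = 6)) := by
  open QuadDyn in
  have h3 : ∀ u : AlgebraicClosure ℚ, u ≠ 0 →
      (Function.minimalPeriod (toMap (sym u)) ((1 : AlgebraicClosure ℚ) : OnePoint _) = 3 ↔
        aeval u quartic = 0) := fun u hu => by
    rw [minimalPeriod_sym_one_eq_three_iff hu]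
    simp [quartic, aeval_def, eval₂_ofNat]
  have h4 : ∀ u : AlgebraicClosure ℚ, u ≠ 0 →
      (Function.minimalPeriod (toMap (sym u)) ((1 : AlgebraicClosure ℚ) : OnePoint _) = 4 ↔
        aeval u (quadraticFactor * sextic) = 0) := fun u hu => by
    rw [minimalPeriod_sym_one_eq_four_iff hu]
    simp [quadraticFactor, sextic, aeval_def, eval₂_ofNat]
  have hgal : IsGalois ℚ (AlgebraicClosure ℚ) := by
    have h (k : Type) [Field k] [CharZero k] : IsGalois k (AlgebraicClosure k) := inferInstance
    convert! h ℚ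
  refine ⟨?_, ⟨?_, fun φ hφ h => ?_⟩, ?_, fun φ hφ h => ?_⟩
  · ext c
    rw [mem_perCurve_inter_symmetryLocus_iff two_pos, Set.mem_singleton_iff, conjClass_inv_sq]
    constructor
    · rintro ⟨u, hu, rfl, h⟩
      rw [(minimalPeriod_sym_one_eq_two_iff hu).1 h]
    · rintro rfl
      exact ⟨-1, by simp, rfl, (minimalPeriod_sym_one_eq_two_iff (by simp)).2 rfl⟩
  · rw [ncard_perCurve_inter_symmetryLocus three_pos (by simp [quartic])
      irreducible_quartic.separable h3, natDegree_quartic]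
  · obtain ⟨u, hu, h⟩ := exists_fieldOfModuli_eq_adjoin three_pos h3 hφ h
    rw [h, finrank_adjoin_of_irreducible monic_quartic irreducible_quartic hu, natDegree_quartic]
  · rw [ncard_perCurve_inter_symmetryLocus four_pos (by simp [quadraticFactor, sextic])
      separable_quadratic_mul_sextic h4, monic_quadraticFactor.natDegree_mul monic_sextic,
      natDegree_quadraticFactor, natDegree_sextic]
  · obtain ⟨u, hu, h⟩ := exists_fieldOfModuli_eq_adjoin four_pos h4 hφ h
    rw [h]
    rw [map_mul, mul_eq_zero] at hu
    refine hu.imp (fun hu => ?_) fun hu => ?_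
    · rw [finrank_adjoin_of_irreducible monic_quadraticFactor irreducible_quadraticFactor hu,
        natDegree_quadraticFactor]
    · rw [finrank_adjoin_of_irreducible monic_sextic irreducible_sextic hu, natDegree_sextic]
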